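/- Let $\mathcal T$ be a triangulated category with small coproducts, with shift functor $[1]$. For a class $\mathcal A$ of objects, ${}^\perp\mathcal A$ consists of the objects $X$ with $\mathrm{Hom}(X,Y)=0$ for all $Y\in\mathcal A$, and $\mathrm{Coprod}(\mathcal A)$ is the smallest class of objects that contains $\mathcal A$ and is closed under extensions and small coproducts. For an object $G$ and integers $m\le n$ (with $m=-\infty$ allowed) put $G[m,n]=\{G[i] : m\le -i\le n\}$, and let $\overline{\langle G\rangle}^{[m,n]}$ be the class of direct summands of objects of $\mathrm{Coprod}(G[m,n])$. Let $\mathcal T^c$ be the class of compact objects; a compact generator is a $G\in\mathcal T^c$ such that $\mathrm{Hom}(G[i],X)=0$ for all $i\in\mathbb Z$ forces $X=0$. $\mathcal T$ is *weakly approximable* if there are an integer $A>0$, a compact generator $G$ and a t-structure $(\mathcal T^{\le 0},\mathcal T^{\ge 1})$ such that $G\in\mathcal T^{\le A}$, $\mathrm{Hom}(G,\mathcal T^{\le -A})=0$, and every $F\in\mathcal T^{\le 0}$ lies in a distinguished triangle $E\to F\to D\to E[1]$ with $E\in\overline{\langle G\rangle}^{[-A,A]}$ and $D\in\mathcal T^{\le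 -1}$. A t-structure is in the *preferred equivalence class* if, for a compact generator $G$, there is an integer $N>0$ with $\mathcal T^{\le -N}\subseteq \mathrm{Coprod}(G(-\infty,0])\subseteq\mathcal T^{\le N}$. For a t-structure in this class, let $\mathcal T^b$ consist of the objects lying in some $\mathcal T^{\le m}$ and in some $\mathcal T^{\ge n}$, let $\mathcal T^-_c$ consist of the objects $F$ such that for every $m>0$ there is a distinguished triangle $E\to F\to D\to E[1]$ with $E\in\mathcal T^c$ and $D\in\mathcal T^{\le -m}$, and put $\mathcal T^b_c=\mathcal T^-_c\cap\mathcal T^b$; these do not depend on the choice of the t-structure in the class. A weakly approximable $\mathcal T$ is *coherent* if for every t-structure in the preferred equivalence class there is an integer $N>0$ such that every $Y\in\mathcal T^-_c$ admits a distinguished triangle $X\to Y\to Z\to X[1]$ with $X\in\mathcal T^-_c\cap\mathcal T^{\le N}$ and $Z\in\mathcal T^b_c\cap\mathcal T^{\ge 0}$. Then the following hold. 1. If $\mathcal T$ is weakly approximable and coherent and $\mathcal T^c\subseteq\mathcal T^b_c$, then ${}^\perp(\mathcal T^b_c)\cap\mathcal T^-_c=\{0\}$. 2. If $R$ is a left coherent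 ring (every finitely generated left ideal is finitely presented), then $\mathcal T=\mathbf D(\mathrm{Mod}\,R)$, the derived category of left $R$-modules, is weakly approximable and coherent and satisfies $\mathcal T^c\subseteq\mathcal T^b_c$; hence ${}^\perp(\mathcal T^b_c)\cap\mathcal T^-_c=\{0\}$. 3. Let $R$ and $S$ be left coherent rings. If there is a triangulated equivalence $\mathbf D^b(\mathrm{mod}\,R)\cong\mathbf D^b(\mathrm{mod}\,S)$, then there is a triangulated equivalence $\mathbf D^b(\mathrm{proj}\,R)\cong\mathbf D^b(\mathrm{proj}\,S)$. Here $\mathbf D^b(\mathrm{mod}\,R)$ is the full subcategory of $\mathbf D(\mathrm{Mod}\,R)$ of objects with bounded cohomology and finitely presented cohomology modules, and $\mathbf D^b(\mathrm{proj}\,R)$ is that of objects isomorphic to bounded complexes of finitely generated projective modules. -/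

import Mathlib

open CategoryTheory Limits Pretriangulated Triangulated Opposite

universe w v u

namespace WeakApprox

section Triangulated

variable (C : Type u) [Category.{v} C] [Preadditive C] [HasZeroObject C] [HasShift C ℤ]
  [∀ n : ℤ, (shiftFunctor C n).Additive] [Pretriangulated C]

/-- The class `T^c` of compact objects: those `X` for which `Hom(X, -)`, as a functor to abelian
groups, preserves all coproducts indexed by sets in the universe `w` (the small sets). -/
def compactObjects : ObjectProperty C := fun X ↦
  ∀ J : Type w, PreservesColimitsOfShape (Discrete J) (preadditiveCoyoneda.obj (op X))

variable {C}

/-- `Coprod P`: the smallest class of objects containing `P` and closed under extensions and under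
small coproducts. (It is closed under isomorphisms, by taking coproducts over a one-point set.) -/
inductive Coprod (P : ObjectProperty C) : C → Prop
  | of (X : C) (hX : P X) : Coprod P X
  | ext (T : Triangle C) (hT : T ∈ distTriang C) (h₁ : Coprod P T.obj₁) (h₃ : Coprod P T.obj₃) :
      Coprod P T.obj₂
  | coproduct {J : Type w} (F : J → C) (c : Cofan F) (hc : IsColimit c)
      (hF : ∀ j, Coprod P (F j)) : Coprod P c.pt

/-- For a set `I` of integers, the objects `G⟦i⟧` with `-i ∈ I`. So `G[m, n]` is
`shiftsIn G (Set.Icc m n)` and `G(-∞, n]` is `shiftsIn G (Set.Iic n)`. -/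
def shiftsIn (G : C) (I : Set ℤ) : ObjectProperty C := fun X ↦
  ∃ i : ℤ, -i ∈ I ∧ Nonempty (X ≅ G⟦i⟧)

/-- The class `⟨G⟩^{[m, n]}` generated with small coproducts: direct summands of objects
of `Coprod (G[m, n])`. -/
def genInterval (G : C) (m n : ℤ) : ObjectProperty C :=
  ObjectProperty.retractClosure (Coprod.{w} (shiftsIn G (Set.Icc m n)))

/-- `G` is a compact generator: it is compact, and an object `X` with `Hom(G⟦i⟧, X) = 0` for all
integers `i` is zero. -/
structure IsCompactGenerator (G : C) : Prop where
  compact : compactObjects.{w} C G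
  generates : ∀ X : C, (∀ (i : ℤ) (f : G⟦i⟧ ⟶ X), f = 0) → IsZero X

variable (C) in
/-- Weakly approximable triangulated categories. The field `hasCoproducts` says that all small
coproducts exist; `t.le n` is `T^{≤ n}`. -/
structure IsWeaklyApproximable : Prop where
  hasCoproducts : HasCoproducts.{w} C
  approx : ∃ (A : ℕ) (G : C) (t : TStructure C), 0 < A ∧ IsCompactGenerator.{w} G ∧
    t.le A G ∧
    (∀ X : C, t.le (-A) X → ∀ f : G ⟶ X, f = 0) ∧
    ∀ F : C, t.le 0 F → ∃ (E D : C) (f : E ⟶ F) (g : F ⟶ D) (h : D ⟶ E⟦(1 : ℤ)⟧),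
      Triangle.mk f g h ∈ distTriang C ∧ genInterval.{w} G (-A) A E ∧ t.le (-1) D

/-- `t` is in the preferred equivalence class of t-structures: for a compact generator `G`, it is
equivalent to the t-structure `T_G` generated by `G`, whose aisle `T_G^{≤ 0}` is
`Coprod (G(-∞, 0])`. -/
def IsPreferred (t : TStructure C) : Prop :=
  ∃ G : C, IsCompactGenerator.{w} G ∧ ∃ N : ℕ, 0 < N ∧
    (∀ X : C, t.le (-N) X → Coprod.{w} (shiftsIn G (Set.Iic 0)) X) ∧
    (∀ X : C, Coprod.{w} (shiftsIn G (Set.Iic 0)) X → t.le N X)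

variable (C)

/-- The class `T^b` of objects that are bounded, for a t-structure in the preferred equivalence
class. (`t.bounded` consists of the `X` in some `T^{≤ m}` and in some `T^{≥ n}`.) -/
def boundedObjects : ObjectProperty C := fun X ↦
  ∃ t : TStructure C, IsPreferred.{w} t ∧ t.bounded X

/-- The class `T^-_c` of pseudo-compact objects `F`: for a t-structure in the preferred equivalence
class and every `m > 0` there is a distinguished triangle `E ⟶ F ⟶ D ⟶ E⟦1⟧` with `E` compact and
`D` in `T^{≤ -m}`. -/
def pseudoCompactObjects : ObjectProperty C := fun F ↦
  ∃ t : TStructure C, IsPreferred.{w} t ∧ ∀ m : ℕ, 0 < m →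
    ∃ (E D : C) (f : E ⟶ F) (g : F ⟶ D) (h : D ⟶ E⟦(1 : ℤ)⟧),
      Triangle.mk f g h ∈ distTriang C ∧ compactObjects.{w} C E ∧ t.le (-m) D

/-- The class `T^b_c` of bounded pseudo-compact objects. -/
def boundedPseudoCompactObjects : ObjectProperty C :=
  pseudoCompactObjects.{w} C ⊓ boundedObjects.{w} C

/-- Coherence (of a weakly approximable triangulated category). -/
def IsCoherent : Prop :=
  ∀ t : TStructure C, IsPreferred.{w} t → ∃ N : ℕ, 0 < N ∧
    ∀ Y : C, pseudoCompactObjects.{w} C Y →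
      ∃ (X Z : C) (f : X ⟶ Y) (g : Y ⟶ Z) (h : Z ⟶ X⟦(1 : ℤ)⟧),
        Triangle.mk f g h ∈ distTriang C ∧
        (pseudoCompactObjects.{w} C X ∧ t.le N X) ∧
        (boundedPseudoCompactObjects.{w} C Z ∧ t.ge 0 Z)

end Triangulated

section Equivalences

/-- The full subcategories given by two classes of objects `P` and `Q`, stable under shifts, are
triangulated equivalent: there is an equivalence that commutes with shifts and takes triangles
which are distinguished (in the ambient category) to distinguished triangles. -/
def TriangulatedEquivalent
    {C : Type*} [Category* C] [Preadditive C] [HasZeroObject C] [HasShift C ℤ]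
    [∀ n : ℤ, (shiftFunctor C n).Additive] [Pretriangulated C]
    {D : Type*} [Category* D] [Preadditive D] [HasZeroObject D] [HasShift D ℤ]
    [∀ n : ℤ, (shiftFunctor D n).Additive] [Pretriangulated D]
    (P : ObjectProperty C) [P.IsStableUnderShift ℤ]
    (Q : ObjectProperty D) [Q.IsStableUnderShift ℤ] : Prop :=
  ∃ (e : P.FullSubcategory ≌ Q.FullSubcategory) (_ : e.functor.CommShift ℤ),
    ∀ T : Triangle P.FullSubcategory, P.ι.mapTriangle.obj T ∈ distTriang C →
      Q.ι.mapTriangle.obj (e.functor.mapTriangle.obj T) ∈ distTriang D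

end Equivalences

section Rings

/-- A ring is left coherent if its finitely generated left ideals are finitely presented. -/
def IsLeftCoherent (R : Type u) [Ring R] : Prop :=
  ∀ I : Ideal R, I.FG → Module.FinitePresentation R I

variable (R : Type u) [Ring R] [HasDerivedCategory.{w} (ModuleCat.{u} R)]

/-- `D^b(mod R)` for a left coherent ring `R`, inside `D(Mod R)`: the objects with bounded
cohomology all of whose cohomology modules are finitely presented. -/
def derivedBoundedMod : ObjectProperty (DerivedCategory (ModuleCat.{u} R)) := fun X ↦
  DerivedCategory.TStructure.t.bounded X ∧
    ∀ n : ℤ, Module.FinitePresentation R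
      ((DerivedCategory.homologyFunctor (ModuleCat.{u} R) n).obj X)

/-- `D^b(proj R)` inside `D(Mod R)`: the objects isomorphic to bounded complexes of
finitely generated projective modules. -/
def derivedBoundedProj : ObjectProperty (DerivedCategory (ModuleCat.{u} R)) := fun X ↦
  ∃ (K : CochainComplex (ModuleCat.{u} R) ℤ) (a b : ℤ), K.IsStrictlyGE a ∧ K.IsStrictlyLE b ∧
    (∀ i : ℤ, Module.Finite R (K.X i) ∧ Module.Projective R (K.X i)) ∧
    Nonempty (X ≅ DerivedCategory.Q.obj K)

instance : (derivedBoundedMod.{w} R).IsStableUnderShift ℤ where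
  isStableUnderShiftBy a :=
    { le_shift := by
        rintro X ⟨hb, hX⟩
        refine ⟨ObjectProperty.le_shift _ a _ hb, fun n ↦ ?_⟩
        let e : (DerivedCategory.homologyFunctor (ModuleCat.{u} R) n).obj (X⟦a⟧) ≅
            (DerivedCategory.homologyFunctor (ModuleCat.{u} R) (a + n)).obj X :=
          ((DerivedCategory.homologyFunctor (ModuleCat.{u} R) 0).shiftIso a n (a + n) rfl).app X
        exact (LinearEquiv.finitePresentation_iff e.toLinearEquiv).2 (hX (a + n)) }

instance : (derivedBoundedProj.{w} R).IsStableUnderShift ℤ where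
  isStableUnderShiftBy n :=
    { le_shift := by
        rintro X ⟨K, a, b, ha, hb, hK, ⟨e⟩⟩
        exact ⟨K⟦n⟧, a - n, b - n, K.isStrictlyGE_shift a n _ (by lia),
          K.isStrictlyLE_shift b n _ (by lia), fun i ↦ hK (i + n),
          ⟨(shiftFunctor _ n).mapIso e ≪≫ (DerivedCategory.Q.commShiftIso n).symm.app K⟩⟩ }

end Rings

end WeakApprox

/-! The orthogonality statement is a boundedness argument. Let `X` be pseudo-compact without maps to
`T^b_c`. All shifts of `X` have the same property, so in the coherence triangle of `X⟦i⟧` the map to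
the bounded part vanishes, and `X⟦i⟧` is a retract of an object of `T^{≤ N}` with `N` independent of
`i`. Hence `X` lies in every `T^{≤ m}`. Since `Hom(G, T^{≤ -A}) = 0`, the generator has no maps to
shifts of `X`, and `X = 0` (`isZero_of_leftOrthogonal`). Coherence speaks of preferred t-structures
only, so the t-structure of weak approximability must be shown to be preferred
(`isPreferred_of_approx`): iterated approximation makes each object of `T^{≤ 0}` a homotopy colimit
of objects built from `G`.

In `D(Mod R)` the ring is a compact generator, and free covers of the top cohomology give weak
approximability with `A = 1`. For coherent `R` the pseudo-compact objects are exactly the bounded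
above ones with finitely presented cohomology (`pseudoCompact_of_fpCohomology`,
`le_and_fpCohomology_of_pseudoCompact`), so the standard truncation triangles prove coherence. The
hard input is that compact objects lie in `D^b(mod R)` (`derivedBoundedMod_of_compact`). It rests on
the factorization of maps from compact objects to `Coprod P` through `P`
(`exists_factorization_of_compact`).

For the equivalences: an object of `D^b(mod R)` is perfect if and only if it has no maps to the
objects of `D^b(mod R)` in degrees `≤ n`, for some `n`. An equivalence moves lower bounds on
cohomology by a bounded amount, because cohomology is represented by shifts of the ring and the
object corresponding to the ring is bounded above. Truncation turns this into preservation of the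
vanishing condition (`derivedBoundedProj_of_equivalence`). -/

namespace WeakApprox

/-! ### Exactness of Hom on distinguished triangles. -/

section DistinguishedTriangles

variable {C : Type u} [Category.{v} C] [Preadditive C] [HasZeroObject C] [HasShift C ℤ]
  [∀ n : ℤ, (shiftFunctor C n).Additive] [Pretriangulated C]
  {X Y Z W : C} {f : X ⟶ Y} {g : Y ⟶ Z} {h : Z ⟶ X⟦(1 : ℤ)⟧}

lemma lift_of_distTriang₁ (hT : Triangle.mk f g h ∈ distTriang C) (k : W ⟶ X) (hk : k ≫ f = 0) :
    ∃ (l : W ⟶ Z⟦(-1 : ℤ)⟧) (m : Z⟦(-1 : ℤ)⟧ ⟶ X), k = l ≫ m := by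
  obtain ⟨l, hl⟩ := Triangle.coyoneda_exact₂ _ (inv_rot_of_distTriang _ hT) k hk
  exact ⟨l, _, hl⟩

lemma lift_of_distTriang₂ (hT : Triangle.mk f g h ∈ distTriang C) (k : W ⟶ Y) (hk : k ≫ g = 0) :
    ∃ l : W ⟶ X, k = l ≫ f :=
  Triangle.coyoneda_exact₂ _ hT k hk

lemma lift_of_distTriang₃ (hT : Triangle.mk f g h ∈ distTriang C) (k : W ⟶ Z) (hk : k ≫ h = 0) :
    ∃ l : W ⟶ Y, k = l ≫ g :=
  Triangle.coyoneda_exact₃ _ hT k hk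

lemma desc_of_distTriang₂ (hT : Triangle.mk f g h ∈ distTriang C) (k : Y ⟶ W) (hk : f ≫ k = 0) :
    ∃ l : Z ⟶ W, k = g ≫ l :=
  Triangle.yoneda_exact₂ _ hT k hk

lemma desc_of_distTriang₃ (hT : Triangle.mk f g h ∈ distTriang C) (k : Z ⟶ W) (hk : g ≫ k = 0) :
    ∃ l : X⟦(1 : ℤ)⟧ ⟶ W, k = h ≫ l :=
  Triangle.yoneda_exact₃ _ hT k hk

lemma distTriang_of_iso {X' Y' Z' : C} {f' : X' ⟶ Y'} {g' : Y' ⟶ Z'} {h' : Z' ⟶ X'⟦(1 : ℤ)⟧}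
    (hT : Triangle.mk f g h ∈ distTriang C) (eX : X ≅ X') (eY : Y ≅ Y') (eZ : Z ≅ Z')
    (hf : f ≫ eY.hom = eX.hom ≫ f') (hg : g ≫ eZ.hom = eY.hom ≫ g')
    (hh : h ≫ eX.hom⟦(1 : ℤ)⟧' = eZ.hom ≫ h') : Triangle.mk f' g' h' ∈ distTriang C :=
  isomorphic_distinguished _ hT _ (Triangle.isoMk _ _ eX eY eZ hf hg hh).symm

lemma distTriang_of_iso₂ {Y' : C} (hT : Triangle.mk f g h ∈ distTriang C) (e : Y ≅ Y') :
    Triangle.mk (f ≫ e.hom) (e.inv ≫ g) h ∈ distTriang C :=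
  distTriang_of_iso hT (Iso.refl _) e (Iso.refl _) (by simp) (by simp) (by simp)

lemma exists_distTriang_of_shift {n : ℤ} {f : X ⟶ W⟦n⟧} {g : W⟦n⟧ ⟶ Z} {h : Z ⟶ X⟦(1 : ℤ)⟧}
    (hT : Triangle.mk f g h ∈ distTriang C) :
    ∃ (f' : X⟦-n⟧ ⟶ W) (g' : W ⟶ Z⟦-n⟧) (h' : Z⟦-n⟧ ⟶ X⟦-n⟧⟦(1 : ℤ)⟧),
      Triangle.mk f' g' h' ∈ distTriang C :=
  ⟨_, _, _, distTriang_of_iso₂ (Triangle.shift_distinguished _ hT (-n))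
    ((shiftFunctorCompIsoId C n (-n) (by simp)).app W)⟩

end DistinguishedTriangles

lemma map_shift_neg_comp {C : Type u} [Category.{v} C] [HasShift C ℤ] {X Y Z : C} {n : ℤ}
    (g : X ⟶ Y⟦-n⟧) (a : Y ⟶ Z) :
    (g ≫ a⟦-n⟧')⟦n⟧' ≫ (shiftFunctorCompIsoId C (-n) n (neg_add_cancel n)).hom.app Z =
      (g⟦n⟧' ≫ (shiftFunctorCompIsoId C (-n) n (neg_add_cancel n)).hom.app Y) ≫ a := by
  rw [Functor.map_comp, Category.assoc, shift_neg_shift' a n, Category.assoc, Category.assoc,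
    Category.assoc, Iso.inv_hom_id_app]
  dsimp
  rw [Category.comp_id]

/-! ### Compact objects: maps to coproducts are finite sums. -/

section Compact

open scoped DirectSum

variable {C : Type u} [Category.{v} C] [Preadditive C]

section

variable {J : Type w} {F : J → C} {c : Cofan F}

/-- The projections from a coproduct in a category with zero morphisms. -/
noncomputable def cofanProj (hc : IsColimit c) (j : J) : c.pt ⟶ F j := by
  classical
  exact Cofan.IsColimit.desc hc fun i ↦ if h : i = j then eqToHom (by rw [h]) else 0

@[simp]
lemma inj_cofanProj_self (hc : IsColimit c) (j : J) : c.inj j ≫ cofanProj hc j = 𝟙 _ := by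
  simp [cofanProj]

lemma inj_cofanProj_of_ne (hc : IsColimit c) {i j : J} (h : i ≠ j) :
    c.inj i ≫ cofanProj hc j = 0 := by
  simp [cofanProj, h]

variable (c) in
/-- The comparison map from the direct sum of the groups `Hom(X, F j)` to the group of morphisms
from `X` to a cofan. -/
noncomputable def sigmaHom (X : C) : (⨁ j, (X ⟶ F j)) →+ (X ⟶ c.pt) := by
  classical
  exact DirectSum.toAddMonoid fun j ↦ Preadditive.rightComp X (c.inj j)

@[simp]
lemma sigmaHom_of [DecidableEq J] {X : C} (j : J) (f : X ⟶ F j) :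
    sigmaHom c X (DirectSum.of (fun j ↦ (X ⟶ F j)) j f) = f ≫ c.inj j := by
  classical
  have := DirectSum.toAddMonoid_of (fun j ↦ Preadditive.rightComp X (c.inj j)) j f
  simp only [sigmaHom]
  convert! this

lemma comp_inj_mem_range {X : C} (j : J) (f : X ⟶ F j) :
    f ≫ c.inj j ∈ (sigmaHom c X).range := by
  classical
  exact ⟨DirectSum.of (fun j ↦ (X ⟶ F j)) j f, sigmaHom_of j f⟩

lemma sigmaHom_range_le {X : C} (S : AddSubgroup (X ⟶ c.pt))
    (h : ∀ (j : J) (f : X ⟶ F j), f ≫ c.inj j ∈ S) : (sigmaHom c X).range ≤ S := by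
  classical
  rintro _ ⟨x, rfl⟩
  induction x using DirectSum.induction_on with
  | zero => simp
  | of j f => simpa using h j f
  | add x y hx hy => simpa using add_mem hx hy

lemma comp_mem_range {X Y : C} (h : X ⟶ Y) {f : Y ⟶ c.pt} (hf : f ∈ (sigmaHom c Y).range) :
    h ≫ f ∈ (sigmaHom c X).range := by
  have := sigmaHom_range_le ((sigmaHom c X).range.comap (Preadditive.leftComp c.pt h))
    (fun j g ↦ by
      change h ≫ g ≫ c.inj j ∈ (sigmaHom c X).range
      rw [← Category.assoc]
      exact comp_inj_mem_range (c := c) j (h ≫ g)) hf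
  exact this

lemma sigmaHom_cofanProj (hc : IsColimit c) {X : C} (x : ⨁ j, (X ⟶ F j)) (j : J) :
    sigmaHom c X x ≫ cofanProj hc j = x j := by
  classical
  induction x using DirectSum.induction_on with
  | zero => simp
  | of i f =>
    by_cases h : i = j
    · subst h; simp
    · simp [inj_cofanProj_of_ne hc h, DirectSum.of_eq_of_ne _ _ _ (Ne.symm h)]
  | add x y hx hy => simp [hx, hy]

lemma sigmaHom_injective (hc : IsColimit c) (X : C) : Function.Injective (sigmaHom c X) := by
  intro x y h
  refine DFinsupp.ext fun j ↦ ?_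
  have := congr_arg (· ≫ cofanProj hc j) h
  simpa [sigmaHom_cofanProj] using this

/-- A morphism to a coproduct that lies in the direct sum is the sum of its components. -/
lemma eq_sum_of_mem_range (hc : IsColimit c) {X : C} {f : X ⟶ c.pt}
    (hf : f ∈ (sigmaHom c X).range) :
    ∃ s : Finset J, f = ∑ j ∈ s, (f ≫ cofanProj hc j) ≫ c.inj j := by
  classical
  obtain ⟨x, rfl⟩ := hf
  refine ⟨x.support, ?_⟩
  simp only [sigmaHom_cofanProj]
  conv_lhs => rw [← DirectSum.sum_support_of x, map_sum]
  simp

end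

/-- An object is compact if and only if the morphisms from it to a coproduct are finite sums of
morphisms to the summands. -/
lemma compactObjects_iff {X : C} : compactObjects.{w} C X ↔
    ∀ (J : Type w) (F : J → C) (c : Cofan F) (_ : IsColimit c) (f : X ⟶ c.pt),
      f ∈ (sigmaHom c X).range := by
  classical
  constructor
  · intro hX J F c hc f
    have := hX J
    have hc' := isColimitOfPreserves (preadditiveCoyoneda.obj (op X)) hc
    -- The quotient by the range kills the image of every summand, so it is zero on the preserved
    -- coproduct.
    let q₀ : (X ⟶ c.pt) →+ (X ⟶ c.pt) ⧸ (sigmaHom (F := F) c X).range :=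
      QuotientAddGroup.mk' (sigmaHom (F := F) c X).range
    let q : (preadditiveCoyoneda.obj (op X)).obj c.pt ⟶
        AddCommGrpCat.of ((X ⟶ c.pt) ⧸ (sigmaHom (F := F) c X).range) :=
      AddCommGrpCat.ofHom q₀
    have hq : q = 0 := by
      refine hc'.hom_ext fun ⟨j⟩ ↦ ?_
      ext g
      exact (QuotientAddGroup.eq_zero_iff _).2 (comp_inj_mem_range (c := c) j g)
    rw [← QuotientAddGroup.eq_zero_iff]
    exact congr_arg (fun φ ↦ φ.hom f) hq
  · intro hX J
    suffices ∀ F : J → C,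
        PreservesColimit (Discrete.functor F) (preadditiveCoyoneda.obj (op X)) from
      ⟨fun {K} ↦ by
        have := this (K.obj ∘ Discrete.mk)
        exact preservesColimit_of_iso_diagram _ (Discrete.natIsoFunctor (F := K)).symm⟩
    refine fun F ↦ ⟨fun {c} hc ↦ ⟨?_⟩⟩
    let c' : Cofan F := c
    let e : (⨁ j, (X ⟶ F j)) ≃+ (X ⟶ c'.pt) := AddEquiv.ofBijective (sigmaHom c' X)
      ⟨sigmaHom_injective hc X, fun f ↦ hX J F c hc f⟩
    have he : ∀ j (f : X ⟶ F j), e.symm (f ≫ c.ι.app ⟨j⟩) = DirectSum.of _ j f := fun j f ↦ by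
      rw [AddEquiv.symm_apply_eq]
      exact (sigmaHom_of (c := c') j f).symm
    let d (s : Cocone (Discrete.functor F ⋙ preadditiveCoyoneda.obj (op X))) :
        (⨁ j, (X ⟶ F j)) →+ s.pt :=
      DirectSum.toAddMonoid fun j ↦ (s.ι.app ⟨j⟩).hom
    have hd (s : Cocone (Discrete.functor F ⋙ preadditiveCoyoneda.obj (op X))) (j) (f : X ⟶ F j) :
        d s (DirectSum.of _ j f) = (s.ι.app ⟨j⟩).hom f := DirectSum.toAddMonoid_of _ _ _
    exact
      { desc := fun s ↦ AddCommGrpCat.ofHom ((d s).comp e.symm.toAddMonoidHom)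
        fac := fun s ⟨j⟩ ↦ by
          ext f
          exact (congr_arg (d s) (he j f)).trans (hd s j f)
        uniq := fun s m hm ↦ by
          ext f
          obtain ⟨x, rfl⟩ := e.surjective f
          have h : m.hom.comp e.toAddMonoidHom = d s := by
            refine DirectSum.addHom_ext fun j f ↦ ?_
            rw [hd]
            have := congr_arg (fun φ ↦ φ.hom f) (hm ⟨j⟩)
            refine Eq.trans ?_ this
            exact congr_arg m.hom (sigmaHom_of (c := c') j f)
          have := DFunLike.congr_fun h x
          refine this.trans (congr_arg (d s) (e.symm_apply_apply x).symm) }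

lemma compactObjects_of_retract {X Y : C} (r : Retract X Y) (hY : compactObjects.{w} C Y) :
    compactObjects.{w} C X := by
  rw [compactObjects_iff] at hY ⊢
  intro J F c hc f
  simpa using comp_mem_range r.i (hY J F c hc (r.r ≫ f))

lemma compactObjects_of_iso {X Y : C} (e : X ≅ Y) (hY : compactObjects.{w} C Y) :
    compactObjects.{w} C X :=
  compactObjects_of_retract (Retract.ofIso e) hY

lemma compactObjects_of_isZero {X : C} (hX : IsZero X) : compactObjects.{w} C X := by
  rw [compactObjects_iff]
  intro J F c hc f
  rw [hX.eq_of_src f 0]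
  exact zero_mem _

lemma compactObjects_biproduct {ι : Type} [Fintype ι] (X : ι → C) [HasBiproduct X]
    (hX : ∀ i, compactObjects.{w} C (X i)) : compactObjects.{w} C (⨁ X) := by
  rw [compactObjects_iff]
  intro J F c hc f
  have : f = ∑ i, biproduct.π X i ≫ biproduct.ι X i ≫ f := by
    simp_rw [← Category.assoc]
    rw [← Preadditive.sum_comp]
    exact ((Category.id_comp f).symm.trans (congr_arg (· ≫ f) (biproduct.total (f := X)).symm))
  rw [this]
  exact sum_mem fun i _ ↦ comp_mem_range _ (compactObjects_iff.1 (hX i) J F c hc _)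

/-- The shift by `-n` preserves coproducts, so a map from `X⟦n⟧` to a coproduct corresponds to a map
from `X` to the coproduct of the shifted summands. -/
lemma compactObjects_shift [HasShift C ℤ] [∀ n : ℤ, (shiftFunctor C n).Additive] {X : C}
    (hX : compactObjects.{w} C X) (n : ℤ) : compactObjects.{w} C (X⟦n⟧) := by
  rw [compactObjects_iff] at hX ⊢
  intro J F c hc f
  let c' : Cofan fun j ↦ (F j)⟦-n⟧ := Cofan.mk (c.pt⟦-n⟧) fun j ↦ (c.inj j)⟦-n⟧'
  have hc' : IsColimit c' :=
    Cofan.isColimitMapCoconeEquiv _ _ c (isColimitOfPreserves (shiftFunctor C (-n)) hc)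
  let e := fun Y : C ↦ (shiftFunctorCompIsoId C (-n) n (neg_add_cancel n)).app Y
  obtain ⟨g, hg⟩ := (shiftFunctor C n).map_surjective (f ≫ (e _).inv)
  have : f = g⟦n⟧' ≫ (e _).hom := by rw [hg]; simp
  rw [this]
  have hS := sigmaHom_range_le (c := c') (X := X)
    ((sigmaHom c (X⟦n⟧)).range.comap ((Preadditive.rightComp _ (e c.pt).hom).comp
      (shiftFunctor C n).mapAddHom)) (fun j g ↦ by
        change (g ≫ (c.inj j)⟦-n⟧')⟦n⟧' ≫ (e c.pt).hom ∈ (sigmaHom c (X⟦n⟧)).range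
        have : (g ≫ (c.inj j)⟦-n⟧')⟦n⟧' ≫ (e c.pt).hom = (g⟦n⟧' ≫ (e (F j)).hom) ≫ c.inj j :=
          map_shift_neg_comp g (c.inj j)
        rw [this]
        exact comp_inj_mem_range (c := c) j _)
  exact hS (hX J _ c' hc' g)

variable [HasZeroObject C] [HasShift C ℤ] [∀ n : ℤ, (shiftFunctor C n).Additive]
  [Pretriangulated C]

lemma compactObjects_ext₂ (T : Triangle C) (hT : T ∈ distTriang C)
    (h₁ : compactObjects.{w} C T.obj₁) (h₃ : compactObjects.{w} C T.obj₃) :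
    compactObjects.{w} C T.obj₂ := by
  rw [compactObjects_iff] at h₁ h₃ ⊢
  intro J F c hc f
  obtain ⟨s, hs⟩ := eq_sum_of_mem_range hc (h₁ J F c hc (T.mor₁ ≫ f))
  -- On `T.obj₁` the map `f` only meets the summands in `s`. Subtracting the components of `f` in
  -- `s` leaves a map that vanishes on `T.obj₁`, hence factors through `T.obj₃`.
  let f' := ∑ j ∈ s, (f ≫ cofanProj hc j) ≫ c.inj j
  have hf' : f' ∈ (sigmaHom c T.obj₂).range := sum_mem fun j _ ↦ comp_inj_mem_range _ _
  obtain ⟨h, hh⟩ := T.yoneda_exact₂ hT (f - f') (by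
    rw [Preadditive.comp_sub, sub_eq_zero, hs]
    simp [f', Preadditive.comp_sum])
  rw [← sub_add_cancel f f', hh]
  exact add_mem (comp_mem_range _ (h₃ J F c hc h)) hf'

end Compact

/-! ### Homotopy colimits of sequences. -/

section Telescope

lemma tel_hom_ext {C : Type u} [Category.{v} C] {E : ℕ ⥤ C}
    [HasCoproduct fun n : ULift.{w} ℕ ↦ E.obj n.down] {X : C}
    {f g : (∐ fun n : ULift.{w} ℕ ↦ E.obj n.down) ⟶ X} (h : ∀ n, 
      Sigma.ι (fun n : ULift.{w} ℕ ↦ E.obj n.down) ⟨n⟩ ≫ f =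
        Sigma.ι (fun n : ULift.{w} ℕ ↦ E.obj n.down) ⟨n⟩ ≫ g) :
    f = g :=
  Sigma.hom_ext _ _ fun ⟨n⟩ ↦ h n

variable {C : Type u} [Category.{v} C] [Preadditive C] (E : ℕ ⥤ C)
  [HasCoproduct fun n : ULift.{w} ℕ ↦ E.obj n.down]

/-- The coproduct of the objects of a sequence, indexed by a type in a given universe. -/
noncomputable abbrev telObj : C := ∐ fun n : ULift.{w} ℕ ↦ E.obj n.down

/-- The inclusions to the coproduct of a sequence. -/
noncomputable abbrev telι (n : ℕ) : E.obj n ⟶ telObj.{w} E :=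
  Sigma.ι (fun n : ULift.{w} ℕ ↦ E.obj n.down) ⟨n⟩

/-- The projections from the coproduct of a sequence. -/
noncomputable def telπ (n : ℕ) : telObj.{w} E ⟶ E.obj n :=
  cofanProj (coproductIsCoproduct fun n : ULift.{w} ℕ ↦ E.obj n.down) ⟨n⟩

/-- The map `1 - shift` on the coproduct of a sequence, whose cone is the homotopy colimit. -/
noncomputable def telMap : telObj.{w} E ⟶ telObj.{w} E :=
  Sigma.desc fun n ↦ telι E n.down - E.map (homOfLE n.down.le_succ) ≫ telι E (n.down + 1)

variable {E}

lemma telι_telMap (n : ℕ) : telι.{w} E n ≫ telMap E =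
    telι E n - E.map (homOfLE n.le_succ) ≫ telι E (n + 1) := by
  simp [telMap]

lemma telι_telπ_self (n : ℕ) : telι.{w} E n ≫ telπ E n = 𝟙 _ :=
  inj_cofanProj_self (coproductIsCoproduct fun n : ULift.{w} ℕ ↦ E.obj n.down) ⟨n⟩

lemma telι_telπ_of_ne {m n : ℕ} (h : m ≠ n) : telι.{w} E m ≫ telπ E n = 0 :=
  inj_cofanProj_of_ne (coproductIsCoproduct fun n : ULift.{w} ℕ ↦ E.obj n.down)
    (i := ⟨m⟩) (j := ⟨n⟩) fun h' ↦ h (congr_arg ULift.down h')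

lemma telMap_telπ_zero : telMap.{w} E ≫ telπ E 0 = telπ E 0 := by
  refine tel_hom_ext fun n ↦ ?_
  rw [← Category.assoc, telι_telMap, Preadditive.sub_comp, Category.assoc,
    telι_telπ_of_ne n.succ_ne_zero, comp_zero, sub_zero]

lemma telMap_telπ_succ (n : ℕ) : telMap.{w} E ≫ telπ E (n + 1) =
    telπ E (n + 1) - telπ E n ≫ E.map (homOfLE n.le_succ) := by
  refine tel_hom_ext fun m ↦ ?_
  rw [← Category.assoc, telι_telMap, Preadditive.sub_comp, Preadditive.comp_sub, Category.assoc]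
  congr 1
  by_cases h : m = n
  · subst h
    rw [telι_telπ_self, ← Category.assoc, telι_telπ_self, Category.comp_id, Category.id_comp]
  · rw [telι_telπ_of_ne (by lia), comp_zero, ← Category.assoc, telι_telπ_of_ne h, zero_comp]

lemma tel_finite {X : C} (hX : compactObjects.{w} C X) (g : X ⟶ telObj.{w} E) :
    ∃ N : ℕ, (∀ n, N ≤ n → g ≫ telπ E n = 0) ∧
      g = ∑ n ∈ Finset.range N, (g ≫ telπ E n) ≫ telι E n := by
  classical
  obtain ⟨s, hs⟩ := eq_sum_of_mem_range
    (coproductIsCoproduct fun n : ULift.{w} ℕ ↦ E.obj n.down)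
    (compactObjects_iff.1 hX _ _ _ (coproductIsCoproduct _) g)
  let s' := s.image ULift.down
  have hs' : g = ∑ n ∈ s', (g ≫ telπ E n) ≫ telι E n := by
    rw [Finset.sum_image ULift.down_injective.injOn]
    exact hs
  have h0 : ∀ n ∉ s', g ≫ telπ E n = 0 := fun n hn ↦ by
    conv_lhs => rw [hs']
    rw [Preadditive.sum_comp]
    refine Finset.sum_eq_zero fun m hm ↦ ?_
    rw [Category.assoc, telι_telπ_of_ne (by rintro rfl; exact hn hm), comp_zero]
  refine ⟨s'.sup id + 1, fun n hn ↦ h0 n fun h ↦ ?_, ?_⟩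
  · have := Finset.le_sup (f := id) h
    simp only [id] at this
    lia
  · conv_lhs => rw [hs']
    refine Finset.sum_subset (fun n hn ↦ ?_) fun n _ hn ↦ by rw [h0 n hn, zero_comp]
    have := Finset.le_sup (f := id) hn
    simp only [id] at this
    simp
    lia

/-- Read component by component, `g ≫ telMap E = 0` forces the components of `g` to vanish one after
the other. Compactness makes `g` the sum of its components. -/
lemma telMap_cancel {X : C} (hX : compactObjects.{w} C X) (g : X ⟶ telObj.{w} E)
    (hg : g ≫ telMap E = 0) : g = 0 := by
  have h : ∀ n, g ≫ telπ E n = 0 := fun n ↦ by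
    induction n with
    | zero => rw [← telMap_telπ_zero, ← Category.assoc, hg, zero_comp]
    | succ n hn =>
      have : g ≫ telMap E ≫ telπ E (n + 1) = 0 := by rw [← Category.assoc, hg, zero_comp]
      rwa [telMap_telπ_succ, Preadditive.comp_sub, ← Category.assoc g (telπ E n), hn, zero_comp,
        sub_zero] at this
  obtain ⟨N, -, hN⟩ := tel_finite hX g
  rw [hN]
  exact Finset.sum_eq_zero fun n _ ↦ by rw [h, zero_comp]

lemma telι_comp {L : C} {q : telObj.{w} E ⟶ L} (hq : telMap E ≫ q = 0) {m n : ℕ} (h : m ≤ n) :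
    E.map (homOfLE h) ≫ telι E n ≫ q = telι E m ≫ q := by
  induction n, h using Nat.le_induction with
  | base => simp
  | succ n hmn ih =>
    rw [← ih, ← homOfLE_comp hmn n.le_succ, E.map_comp, Category.assoc]
    congr 1
    have h : (telι E n ≫ telMap E) ≫ q = 0 := by rw [Category.assoc, hq, comp_zero]
    rw [telι_telMap, Preadditive.sub_comp, sub_eq_zero, Category.assoc] at h
    exact h.symm

/-- Only finitely many components of `g` are nonzero, and after composition with `q` they can all be
pushed along the sequence to one common index. -/
lemma tel_comp_factors {X : C} (hX : compactObjects.{w} C X) (g : X ⟶ telObj.{w} E) {L : C}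
    {q : telObj.{w} E ⟶ L} (hq : telMap E ≫ q = 0) :
    ∃ N : ℕ, ∀ n, N ≤ n → ∃ h : X ⟶ E.obj n, h ≫ telι E n ≫ q = g ≫ q := by
  obtain ⟨N, -, hN⟩ := tel_finite hX g
  refine ⟨N, fun n hn ↦ ⟨∑ i ∈ (Finset.range N).attach, (g ≫ telπ E i) ≫
    E.map (homOfLE ((Finset.mem_range.1 i.2).le.trans hn)), ?_⟩⟩
  conv_rhs => rw [hN]
  rw [Preadditive.sum_comp, Preadditive.sum_comp, ← Finset.sum_attach (Finset.range N)]
  refine Finset.sum_congr rfl fun i _ ↦ ?_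
  rw [Category.assoc, telι_comp hq, Category.assoc (g ≫ telπ E i)]

variable [HasZeroObject C] [HasShift C ℤ] [∀ n : ℤ, (shiftFunctor C n).Additive]
  [Pretriangulated C]

section

variable {L : C} {q : telObj.{w} E ⟶ L} {δ : L ⟶ (telObj.{w} E)⟦(1 : ℤ)⟧}

/-- A morphism from a compact object to a homotopy colimit factors through the sequence. -/
lemma factors_of_telescope (hT : Triangle.mk (telMap.{w} E) q δ ∈ distTriang C)
    {X : C} (hX : compactObjects.{w} C X) (f : X ⟶ L) :
    ∃ N : ℕ, ∀ n, N ≤ n → ∃ h : X ⟶ E.obj n, h ≫ telι E n ≫ q = f := by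
  have hq : telMap E ≫ q = 0 := comp_distTriang_mor_zero₁₂ _ hT
  let e : (X⟦(-1 : ℤ)⟧)⟦(1 : ℤ)⟧ ≅ X := (shiftFunctorCompIsoId C (-1) 1 (by simp)).app X
  -- The desuspension of `f ≫ δ` is killed by `telMap E`, so it vanishes and `f` lifts to the
  -- coproduct.
  obtain ⟨k, hk⟩ := (shiftFunctor C (1 : ℤ)).map_surjective (e.hom ≫ f ≫ δ)
  have hk0 : k = 0 := by
    refine telMap_cancel (compactObjects_shift hX (-1)) k
      ((shiftFunctor C (1 : ℤ)).map_injective ?_)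
    have : δ ≫ (telMap E)⟦(1 : ℤ)⟧' = 0 := comp_distTriang_mor_zero₃₁ _ hT
    rw [Functor.map_comp, hk, Category.assoc, Category.assoc, this, comp_zero, comp_zero,
      Functor.map_zero]
  have hf : f ≫ δ = 0 := by
    rw [← cancel_epi e.hom, ← hk, hk0, Functor.map_zero, comp_zero]
  obtain ⟨g, hg⟩ := lift_of_distTriang₃ hT f hf
  obtain ⟨N, hN⟩ := tel_comp_factors hX g hq
  exact ⟨N, fun n hn ↦ (hN n hn).imp fun h hh ↦ hh.trans hg.symm⟩

/-- A morphism from a compact object to an object of a sequence that vanishes in the homotopy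
colimit vanishes further along in the sequence. -/
lemma eventually_zero_of_telescope (hT : Triangle.mk (telMap.{w} E) q δ ∈ distTriang C)
    {X : C} (hX : compactObjects.{w} C X) {n : ℕ} (h : X ⟶ E.obj n) (hh : h ≫ telι E n ≫ q = 0) :
    ∃ m, ∃ hm : n ≤ m, h ≫ E.map (homOfLE hm) = 0 := by
  obtain ⟨g, hg⟩ := lift_of_distTriang₂ hT (h ≫ telι E n) (by rw [Category.assoc, hh])
  -- Solving `h ≫ telι E n = g ≫ telMap E` for the components of `g` gives zero below `n`, then `h`
  -- in place `n`, and the images of `h` under the transition maps above `n`. Since `g` has finitely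
  -- many components, these images are eventually zero.
  obtain ⟨N, hN, -⟩ := tel_finite hX g
  have h0 : ∀ j < n, g ≫ telπ E j = 0 := fun j hj ↦ by
    induction j with
    | zero =>
      rw [← telMap_telπ_zero, ← Category.assoc, ← hg, Category.assoc,
        telι_telπ_of_ne (by lia), comp_zero]
    | succ j ih =>
      have : (h ≫ telι E n) ≫ telπ E (j + 1) = g ≫ telMap E ≫ telπ E (j + 1) := by
        rw [hg, Category.assoc]
      rwa [telMap_telπ_succ, Preadditive.comp_sub, ← Category.assoc g (telπ E j), ih (by lia),
        zero_comp, sub_zero, Category.assoc, telι_telπ_of_ne (by lia), comp_zero, eq_comm] at this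
  have h1 : g ≫ telπ E n = h := by
    have : (h ≫ telι E n) ≫ telπ E n = g ≫ telMap E ≫ telπ E n := by rw [hg, Category.assoc]
    rw [Category.assoc, telι_telπ_self, Category.comp_id] at this
    rw [this]
    cases n with
    | zero => rw [telMap_telπ_zero]
    | succ n =>
      rw [telMap_telπ_succ, Preadditive.comp_sub, ← Category.assoc g (telπ E n), h0 n (by lia),
        zero_comp, sub_zero]
  have h2 : ∀ m (hm : n ≤ m), g ≫ telπ E m = h ≫ E.map (homOfLE hm) := fun m hm ↦ by
    induction m, hm using Nat.le_induction with
    | base => simpa using h1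
    | succ m hm ih =>
      have : (h ≫ telι E n) ≫ telπ E (m + 1) = g ≫ telMap E ≫ telπ E (m + 1) := by
        rw [hg, Category.assoc]
      rw [telMap_telπ_succ, Preadditive.comp_sub, ← Category.assoc g (telπ E m), ih,
        Category.assoc, telι_telπ_of_ne (by lia), comp_zero, eq_comm, sub_eq_zero] at this
      rw [this, Category.assoc, ← E.map_comp, homOfLE_comp]
  refine ⟨max n N, le_max_left _ _, ?_⟩
  rw [← h2, hN _ (le_max_right _ _)]

end

/-- If maps from the shifts of a compact generator to a sequence are eventually zero, then
every map from a compact object to the sequence becomes zero. -/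
lemma exists_map_eq_zero {G X : C} (hG : IsCompactGenerator.{w} G) (hX : compactObjects.{w} C X)
    (hE : ∀ i : ℤ, ∃ N : ℕ, ∀ n, N ≤ n → ∀ f : G⟦i⟧ ⟶ E.obj n, f = 0) (h : X ⟶ E.obj 0) :
    ∃ n : ℕ, h ≫ E.map (homOfLE n.zero_le) = 0 := by
  obtain ⟨L, q, δ, hT⟩ := distinguished_cocone_triangle (telMap.{w} E)
  have hL : IsZero L := hG.generates L fun i f ↦ by
    obtain ⟨N, hN⟩ := factors_of_telescope hT (compactObjects_shift hG.compact i) f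
    obtain ⟨M, hM⟩ := hE i
    obtain ⟨k, rfl⟩ := hN (max N M) (le_max_left _ _)
    rw [hM _ (le_max_right _ _) k, zero_comp]
  obtain ⟨m, _, hm⟩ := eventually_zero_of_telescope hT hX h (hL.eq_of_tgt _ _)
  exact ⟨m, hm⟩

end Telescope

/-! ### The Eilenberg swindle for a retract. -/

section Retracts

variable {C : Type u} [Category.{v} C] [Preadditive C]

section

variable {X Y : C} (r : Retract X Y) [HasCoproduct fun _ : ULift.{w} ℕ ↦ Y]

/-- The map from a countable coproduct of copies of `Y` to itself that shifts the retract `X`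
of `Y` one step forward and is the identity on the complement of `X`. -/
noncomputable def swindleHom : (∐ fun _ : ULift.{w} ℕ ↦ Y) ⟶ ∐ fun _ : ULift.{w} ℕ ↦ Y :=
  Sigma.desc fun n ↦ (𝟙 _ - r.r ≫ r.i) ≫ Sigma.ι (fun _ : ULift.{w} ℕ ↦ Y) n +
    (r.r ≫ r.i) ≫ Sigma.ι (fun _ : ULift.{w} ℕ ↦ Y) ⟨n.down + 1⟩

/-- The retraction of `swindleHom`. -/
noncomputable def swindleInv : (∐ fun _ : ULift.{w} ℕ ↦ Y) ⟶ ∐ fun _ : ULift.{w} ℕ ↦ Y :=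
  Sigma.desc fun n ↦ (𝟙 _ - r.r ≫ r.i) ≫ Sigma.ι (fun _ : ULift.{w} ℕ ↦ Y) n +
    if n.down = 0 then 0 else (r.r ≫ r.i) ≫ Sigma.ι (fun _ : ULift.{w} ℕ ↦ Y) ⟨n.down - 1⟩

/-- The projection onto the retract of the first summand. -/
noncomputable def swindleProj : (∐ fun _ : ULift.{w} ℕ ↦ Y) ⟶ X :=
  Sigma.desc fun n ↦ if n.down = 0 then r.r else 0

/-- The Eilenberg swindle. -/
noncomputable def swindleIso [HasBinaryBiproduct (∐ fun _ : ULift.{w} ℕ ↦ Y) X] :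
    (∐ fun _ : ULift.{w} ℕ ↦ Y) ⊞ X ≅ ∐ fun _ : ULift.{w} ℕ ↦ Y where
  hom := biprod.desc (swindleHom r) (r.i ≫ Sigma.ι (fun _ : ULift.{w} ℕ ↦ Y) ⟨0⟩)
  inv := biprod.lift (swindleInv r) (swindleProj r)
  hom_inv_id := by
    ext ⟨n⟩
    · cases n <;> simp [swindleHom, swindleInv]
    · cases n <;> simp [swindleHom, swindleProj]
    · simp [swindleInv]
    · simp [swindleProj, r.retract]
  inv_hom_id := by
    ext ⟨n⟩
    cases n with
    | zero => simp [swindleHom, swindleInv, swindleProj, biprod.lift_desc]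
    | succ n => simp [swindleHom, swindleInv, swindleProj, biprod.lift_desc]

end

end Retracts

/-! ### Permanence properties of `Coprod`. -/

section Coprod

variable {C : Type u} [Category.{v} C] [Preadditive C] [HasZeroObject C] [HasShift C ℤ]
  [∀ n : ℤ, (shiftFunctor C n).Additive] [Pretriangulated C] {P Q : ObjectProperty C}

lemma Coprod.of_iso {X Y : C} (e : X ≅ Y) (hX : Coprod.{w} P X) : Coprod.{w} P Y :=
  .coproduct (J := PUnit.{w + 1}) (fun _ ↦ X) (Cofan.mk Y fun _ ↦ e.hom)
    (Cofan.IsColimit.mk _ (fun s ↦ e.inv ≫ s.inj ⟨⟩) (by simp [Cofan.inj])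
      (fun s m h ↦ by simp [← h])) fun _ ↦ hX

lemma Coprod.of_isZero {X : C} (hX : IsZero X) : Coprod.{w} P X :=
  .coproduct (J := PEmpty.{w + 1}) (fun _ ↦ X) (Cofan.mk X PEmpty.elim)
    (Cofan.IsColimit.mk _ (fun _ ↦ hX.to_ _) (fun _ j ↦ j.elim)
      (fun _ _ _ ↦ hX.eq_of_src _ _)) fun j ↦ j.elim

lemma Coprod.mono (h : ∀ X, P X → Coprod.{w} Q X) {X : C} (hX : Coprod.{w} P X) :
    Coprod.{w} Q X := by
  induction hX with
  | of X hX => exact h X hX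
  | ext T hT _ _ h₁ h₃ => exact .ext T hT h₁ h₃
  | coproduct F c hc _ h => exact .coproduct F c hc h

lemma Coprod.shift {n : ℤ} (h : ∀ X, P X → Coprod.{w} Q (X⟦n⟧)) {X : C} (hX : Coprod.{w} P X) :
    Coprod.{w} Q (X⟦n⟧) := by
  induction hX with
  | of X hX => exact h X hX
  | ext T hT _ _ h₁ h₃ => exact .ext _ (Triangle.shift_distinguished T hT n) h₁ h₃
  | coproduct F c hc _ h =>
    exact .coproduct _ _ (Cofan.isColimitMapCoconeEquiv _ _ c
      (isColimitOfPreserves (shiftFunctor C n) hc)) h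

lemma Coprod.shift_shiftsIn {G : C} {I I' : Set ℤ} {n : ℤ} (h : ∀ i ∈ I, i - n ∈ I') {X : C}
    (hX : Coprod.{w} (shiftsIn G I) X) : Coprod.{w} (shiftsIn G I') (X⟦n⟧) := by
  refine hX.shift fun X ↦ ?_
  rintro ⟨i, hi, ⟨e⟩⟩
  refine .of _ ⟨i + n, ?_, ⟨(shiftFunctor C n).mapIso e ≪≫ (shiftFunctorAdd C i n).symm.app G⟩⟩
  convert h _ hi using 1
  ring

lemma Coprod.mono_shiftsIn {G : C} {I I' : Set ℤ} (h : I ⊆ I') {X : C}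
    (hX : Coprod.{w} (shiftsIn G I) X) : Coprod.{w} (shiftsIn G I') X :=
  hX.mono fun _ ⟨i, hi, e⟩ ↦ .of _ ⟨i, h hi, e⟩

/-- If `S` is a countable coproduct of copies of `Y`, the swindle gives `S ⊞ X ≅ S`. The triangle `S
⊞ X ⟶ X ⟶ S⟦1⟧` then exhibits `X` as an extension. The interval is unbounded below so that `S⟦1⟧`
stays in the class. -/
lemma Coprod.of_retract [HasCoproducts.{w} C] {G : C} {a : ℤ} {X Y : C} (r : Retract X Y)
    (hY : Coprod.{w} (shiftsIn G (Set.Iic a)) Y) : Coprod.{w} (shiftsIn G (Set.Iic a)) X := by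
  have hS : Coprod.{w} (shiftsIn G (Set.Iic a)) (∐ fun _ : ULift.{w} ℕ ↦ Y) :=
    .coproduct _ _ (coproductIsCoproduct _) fun _ ↦ hY
  refine .ext _ (rot_of_distTriang _
    (binaryBiproductTriangle_distinguished (∐ fun _ : ULift.{w} ℕ ↦ Y) X)) ?_ ?_
  · exact hS.of_iso (swindleIso r).symm
  · refine hS.shift_shiftsIn fun i hi ↦ ?_
    simp only [Set.mem_Iic] at hi ⊢
    lia

end Coprod

/-! ### Aisles under retracts, extensions and coproducts. -/

section TStructure

variable {C : Type u} [Category.{v} C] [Preadditive C] [HasZeroObject C] [HasShift C ℤ]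
  [∀ n : ℤ, (shiftFunctor C n).Additive] [Pretriangulated C] (t : TStructure C)

lemma le_of_retract {X Y : C} (r : Retract X Y) {n : ℤ} (hY : t.le n Y) : t.le n X := by
  rw [t.le_iff_isLE, t.isLE_iff_orthogonal n (n + 1) rfl] at hY ⊢
  intro Z f hZ
  rw [← Category.id_comp f, ← r.retract, Category.assoc, hY _ (r.r ≫ f) hZ, comp_zero]

lemma ge_of_retract {X Y : C} (r : Retract X Y) {n : ℤ} (hY : t.ge n Y) : t.ge n X := by
  rw [t.ge_iff_isGE, t.isGE_iff_orthogonal (n - 1) n (by simp)] at hY ⊢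
  intro Z f hZ
  rw [← Category.comp_id f, ← r.retract, ← Category.assoc, hY _ (f ≫ r.i) hZ, zero_comp]

/-- An aisle is a left orthogonal, and left orthogonals are closed under coproducts. -/
lemma le_of_coprod {P : ObjectProperty C} {n : ℤ} (h : ∀ X, P X → t.le n X) {X : C}
    (hX : Coprod.{w} P X) : t.le n X := by
  induction hX with
  | of X hX => exact h X hX
  | ext T hT _ _ h₁ h₃ => exact (t.isLE₂ T hT n ⟨h₁⟩ ⟨h₃⟩).le
  | coproduct F c hc _ h =>
    rw [t.le_iff_isLE, t.isLE_iff_orthogonal n (n + 1) rfl]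
    intro Z f hZ
    refine Cofan.IsColimit.hom_ext hc _ _ fun j ↦ ?_
    have := h j
    rw [t.le_iff_isLE] at this
    rw [comp_zero, t.zero (c.inj j ≫ f) n (n + 1)]

lemma le_of_coprod_shiftsIn {G : C} {n a b : ℤ} (hG : t.le n G) (h : a + n ≤ b) {X : C}
    (hX : Coprod.{w} (shiftsIn G (Set.Iic a)) X) : t.le b X := by
  refine le_of_coprod t (fun X ↦ ?_) hX
  rintro ⟨i, hi, ⟨e⟩⟩
  simp only [Set.mem_Iic] at hi
  refine (t.le b).prop_of_iso e.symm (t.le_monotone ?_ _ (t.le_shift n i (n - i) (by ring) _ hG))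
  lia

lemma zero_of_le_of_ge {X Y : C} {m n : ℤ} (h : m < n) (hX : t.le m X) (hY : t.ge n Y)
    (f : X ⟶ Y) : f = 0 :=
  t.zero_of_isLE_of_isGE f m n h ⟨hX⟩ ⟨hY⟩

end TStructure

/-! ### Towers of approximations, and why the given t-structure is preferred. -/

section Approximation

open scoped ZeroObject

variable {C : Type u} [Category.{v} C] [Preadditive C] [HasZeroObject C] [HasShift C ℤ]
  [∀ n : ℤ, (shiftFunctor C n).Additive] [Pretriangulated C]

lemma hom_shift_eq_zero (t : TStructure C) {G X : C} {a m i : ℤ}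
    (hG : ∀ Y : C, t.le a Y → ∀ f : G ⟶ Y, f = 0) (hX : t.le m X) (h : m + i ≤ a)
    (f : G⟦i⟧ ⟶ X) : f = 0 := by
  let e := (shiftFunctorCompIsoId C i (-i) (by simp)).app G
  apply (shiftFunctor C (-i)).map_injective
  rw [← cancel_epi e.inv, Functor.map_zero, comp_zero]
  exact hG _ (t.le_monotone h _ (t.le_shift m (-i) (m + i) (by ring) _ hX)) _

/-- An approximation of `F` by an object of a class `P`, up to an object of `t.le n`. -/
structure Approximation (t : TStructure C) (P : ObjectProperty C) (F : C) (n : ℤ) where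
  /-- the approximating object -/
  E : C
  /-- the error term -/
  D : C
  /-- the map from the approximating object -/
  f : E ⟶ F
  /-- the map to the error term -/
  g : F ⟶ D
  /-- the connecting map -/
  h : D ⟶ E⟦(1 : ℤ)⟧
  dist : Triangle.mk f g h ∈ distTriang C
  mem : P E
  le : t.le n D

/-- By the octahedral axiom, the fibre of the composite `F ⟶ a.D ⟶ b.D` is an extension of `b.E` by
`a.E`. -/
lemma Approximation.exists_succ [IsTriangulated C] {t : TStructure C} {P : ObjectProperty C}
    (hP : ∀ T ∈ distTriang C, P T.obj₁ → P T.obj₃ → P T.obj₂) {F : C} {m n : ℤ}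
    (a : Approximation t P F m) (b : Approximation t P a.D n) :
    ∃ (c : Approximation t P F n) (e : a.E ⟶ c.E), e ≫ c.f = a.f := by
  obtain ⟨E, f, h, hT⟩ := distinguished_cocone_triangle₁ (a.g ≫ b.g)
  let o := someOctahedron' rfl a.dist b.dist hT
  exact ⟨⟨E, b.D, f, _, h, hT, hP _ o.mem a.mem b.mem, b.le⟩, o.m₁, o.comm₁⟩

/-- An object with a sequence of approximations whose error terms move to `-∞` is the homotopy
colimit of the sequence. -/
lemma exists_distTriang_of_sequence [HasCoproducts.{w} C] {t : TStructure C} {G : C}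
    (hG : IsCompactGenerator.{w} G) {a : ℤ} (ha : ∀ Y : C, t.le a Y → ∀ f : G ⟶ Y, f = 0)
    (E : ℕ ⥤ C) {F : C} {D : ℕ → C} {f : ∀ n, E.obj n ⟶ F} {g : ∀ n, F ⟶ D n}
    {h : ∀ n, D n ⟶ (E.obj n)⟦(1 : ℤ)⟧}
    (hE : ∀ n, Triangle.mk (f n) (g n) (h n) ∈ distTriang C) (hD : ∀ n : ℕ, t.le (-n) (D n))
    (hf : ∀ n : ℕ, E.map (homOfLE n.le_succ) ≫ f (n + 1) = f n) :
    ∃ (u : telObj.{w} E ⟶ telObj.{w} E) (v : telObj.{w} E ⟶ F)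
      (w : F ⟶ (telObj.{w} E)⟦(1 : ℤ)⟧), Triangle.mk u v w ∈ distTriang C := by
  obtain ⟨L, q, δ, hT⟩ := distinguished_cocone_triangle (telMap.{w} E)
  let d : telObj.{w} E ⟶ F := Sigma.desc fun n ↦ f n.down
  have hd (n : ℕ) : telι.{w} E n ≫ d = f n := Sigma.ι_desc _ _
  obtain ⟨ψ, hψ⟩ := desc_of_distTriang₂ hT d (by
    refine tel_hom_ext fun n ↦ ?_
    change telι E n ≫ telMap E ≫ d = telι E n ≫ 0
    rw [← Category.assoc, telι_telMap, Preadditive.sub_comp, Category.assoc, hd, hd, hf, sub_self,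
      comp_zero])
  have hfψ (n : ℕ) : telι.{w} E n ≫ q ≫ ψ = f n := by rw [← hψ, hd]
  have hsurj (i : ℤ) (k : G⟦i⟧ ⟶ F) : ∃ l : G⟦i⟧ ⟶ L, k = l ≫ ψ := by
    obtain ⟨n, hn⟩ : ∃ n : ℕ, -(n : ℤ) + i ≤ a := ⟨(i - a).toNat, by lia⟩
    obtain ⟨l, hl⟩ := lift_of_distTriang₂ (hE n) k (hom_shift_eq_zero t ha (hD n) hn _)
    exact ⟨l ≫ telι E n ≫ q, by rw [hl, ← hfψ n, Category.assoc, Category.assoc]⟩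
  have hinj (i : ℤ) (k : G⟦i⟧ ⟶ L) (hk : k ≫ ψ = 0) : k = 0 := by
    obtain ⟨N, hN⟩ := factors_of_telescope hT (compactObjects_shift hG.compact i) k
    -- The kernel of `Hom(G⟦i⟧, E.obj n) → Hom(G⟦i⟧, F)` comes from `(D n)⟦-1⟧`, which lies one
    -- degree higher than `D n`. This accounts for `1 - n`.
    obtain ⟨n, hn, hn'⟩ : ∃ n : ℕ, N ≤ n ∧ 1 - (n : ℤ) + i ≤ a :=
      ⟨N + (1 + i - a).toNat, by lia, by lia⟩
    obtain ⟨k', rfl⟩ := hN n hn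
    obtain ⟨l, m, hl⟩ := lift_of_distTriang₁ (hE n) k' (by
      rw [← hfψ n, ← hk, Category.assoc, Category.assoc])
    have : l = 0 := hom_shift_eq_zero t ha (t.le_shift _ (-1) (1 - n) (by ring) _ (hD n)) hn' l
    rw [hl, this, zero_comp, zero_comp]
  obtain ⟨Z, p, ε, hZ⟩ := distinguished_cocone_triangle ψ
  have hZ0 : IsZero Z := hG.generates Z fun i k ↦ by
    let e : G⟦i - 1⟧⟦(1 : ℤ)⟧ ≅ G⟦i⟧ := (shiftFunctorAdd' C (i - 1) 1 i (by ring)).symm.app G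
    obtain ⟨l, hl⟩ := (shiftFunctor C (1 : ℤ)).map_surjective (e.hom ≫ k ≫ ε)
    have hl0 : l = 0 := by
      refine hinj _ l ((shiftFunctor C (1 : ℤ)).map_injective ?_)
      have : ε ≫ ψ⟦(1 : ℤ)⟧' = 0 := comp_distTriang_mor_zero₃₁ _ hZ
      rw [Functor.map_comp, hl, Category.assoc, Category.assoc, this, comp_zero, comp_zero,
        Functor.map_zero]
    obtain ⟨k', rfl⟩ := lift_of_distTriang₃ hZ k (by
      rw [← cancel_epi e.hom, ← hl, hl0, Functor.map_zero, comp_zero])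
    obtain ⟨l, rfl⟩ := hsurj i k'
    have : ψ ≫ p = 0 := comp_distTriang_mor_zero₁₂ _ hZ
    rw [Category.assoc, this, comp_zero]
  have : IsIso ψ := (Triangle.isZero₃_iff_isIso₁ _ hZ).1 hZ0
  exact ⟨telMap E, q ≫ ψ, inv ψ ≫ δ,
    distTriang_of_iso hT (Iso.refl _) (Iso.refl _) (asIso ψ) (by simp) (by simp) (by simp)⟩

lemma exists_tower [IsTriangulated C] {t : TStructure C} {P : ObjectProperty C}
    (hP₀ : P 0) (hP : ∀ T ∈ distTriang C, P T.obj₁ → P T.obj₃ → P T.obj₂)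
    (h : ∀ (n : ℕ) (D : C), t.le (-n) D → Nonempty (Approximation t P D (-(n + 1 : ℕ))))
    {F : C} (hF : t.le 0 F) :
    ∃ A : ∀ n : ℕ, Approximation t P F (-n),
      ∀ n, ∃ e : (A n).E ⟶ (A (n + 1)).E, e ≫ (A (n + 1)).f = (A n).f := by
  have h' (n : ℕ) (a : Approximation t P F (-n)) :
      ∃ (c : Approximation t P F (-(n + 1 : ℕ))) (e : a.E ⟶ c.E), e ≫ c.f = a.f :=
    a.exists_succ hP (h n _ a.le).some
  choose s hs using h'
  -- The tower starts with the zero object, whose error term is `F` itself; each step approximates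
  -- the previous error term.
  let A₀ : Approximation t P F (-(0 : ℕ)) :=
    ⟨0, F, 0, 𝟙 F, 0, contractible_distinguished₁ F, hP₀, by simpa using hF⟩
  exact ⟨fun n ↦ Nat.rec A₀ s n, fun n ↦ hs n _⟩

/-- The t-structure in the definition of weak approximability is in the preferred equivalence
class. -/
lemma isPreferred_of_approx [IsTriangulated C] [HasCoproducts.{w} C] {A : ℕ} {G : C}
    {t : TStructure C} (hA : 0 < A) (hG : IsCompactGenerator.{w} G) (hGA : t.le A G)
    (ha : ∀ X : C, t.le (-A) X → ∀ f : G ⟶ X, f = 0)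
    (happ : ∀ F : C, t.le 0 F → ∃ (E D : C) (f : E ⟶ F) (g : F ⟶ D) (h : D ⟶ E⟦(1 : ℤ)⟧),
      Triangle.mk f g h ∈ distTriang C ∧ genInterval.{w} G (-A) A E ∧ t.le (-1) D) :
    IsPreferred.{w} t := by
  refine ⟨G, hG, A, hA, fun X hX ↦ ?_,
    fun X hX ↦ le_of_coprod_shiftsIn t hGA (by simp) hX⟩
  -- Only the upper end of the interval is kept. The class is then closed under `⟦1⟧`, as needed for
  -- retracts and for the telescope triangle.
  let P : ObjectProperty C := Coprod.{w} (shiftsIn G (Set.Iic (A : ℤ)))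
  have key {F : C} (hF : t.le 0 F) : P F := by
    obtain ⟨T, hT⟩ := exists_tower (P := P) (.of_isZero (isZero_zero C))
      (fun T hT h₁ h₃ ↦ .ext T hT h₁ h₃) (fun n D hD ↦ by
        obtain ⟨E, D', f, g, h, hT, ⟨E', hE', ⟨r⟩⟩, hD'⟩ :=
          happ (D⟦-(n : ℤ)⟧) (t.le_shift (-n) (-n) 0 (by simp) _ hD)
        obtain ⟨f', g', h', hT'⟩ := exists_distTriang_of_shift hT
        refine ⟨⟨_, _, f', g', h', hT', ?_, t.le_shift _ _ _ (by push_cast; ring) _ hD'⟩⟩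
        refine Coprod.shift_shiftsIn (I := Set.Iic (A : ℤ)) (fun i hi ↦ ?_)
          (Coprod.of_retract r (hE'.mono_shiftsIn fun i hi ↦ hi.2))
        simp only [Set.mem_Iic] at hi ⊢
        lia) hF
    choose e he using hT
    obtain ⟨u, v, w, hd⟩ := exists_distTriang_of_sequence hG ha (Functor.ofSequence e)
      (fun n ↦ (T n).dist) (fun n ↦ (T n).le) fun n ↦ by
        rw [Functor.ofSequence_map_homOfLE_succ]
        exact he n
    have hS : P (telObj (Functor.ofSequence e)) :=
      .coproduct _ _ (coproductIsCoproduct _) fun n ↦ (T n.down).mem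
    -- The rotated telescope triangle makes `F` an extension of `S⟦1⟧` by `S`, where `S` is the
    -- coproduct of the approximations.
    refine .ext _ (rot_of_distTriang _ hd) hS ?_
    refine hS.shift_shiftsIn fun i hi ↦ ?_
    simp only [Set.mem_Iic] at hi ⊢
    lia
  -- The object `X⟦-A⟧` lies in `t.le 0`, hence is built from `G(-∞, A]`; shifting back by `A` moves
  -- the bound `A` to `0`.
  have h := Coprod.shift_shiftsIn (I' := Set.Iic 0) (n := A) (fun i hi ↦ by
    simp only [Set.mem_Iic] at hi ⊢
    lia) (key (t.le_shift (-A) (-A) 0 (by simp) _ hX))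
  exact h.of_iso ((shiftFunctorCompIsoId C (-(A : ℤ)) A (by simp)).app X)

end Approximation

/-! ### Independence of the preferred t-structure, and the orthogonality statement. -/

section Preferred

variable {C : Type u} [Category.{v} C] [Preadditive C] [HasZeroObject C] [HasShift C ℤ]
  [∀ n : ℤ, (shiftFunctor C n).Additive] [Pretriangulated C]

lemma retract_of_distTriang_of_eq_zero {X Y Z : C} {f : X ⟶ Y} {g : Y ⟶ Z}
    {h : Z ⟶ X⟦(1 : ℤ)⟧} (hT : Triangle.mk f g h ∈ distTriang C) (hg : g = 0) :
    Nonempty (Retract Y X) := by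
  obtain ⟨i, hi⟩ := lift_of_distTriang₂ hT (𝟙 Y) (by rw [hg, comp_zero])
  exact ⟨⟨i, f, hi.symm⟩⟩

lemma le_of_forall_shift {t t' : TStructure C} {m n : ℤ} (h : ∀ X : C, t.le m X → t'.le n X)
    (k : ℤ) {X : C} (hX : t.le k X) : t'.le (k + (n - m)) X := by
  have := h _ (t.le_shift k (k - m) m (by ring) X hX)
  rw [t'.le_iff_isLE] at this ⊢
  exact t'.isLE_of_shift X _ (k - m) n (by ring)

/-- A compact object is bounded above for every t-structure in the preferred equivalence
class. -/
lemma exists_le_of_compact [HasCoproducts.{w} C] {t : TStructure C} (ht : IsPreferred.{w} t)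
    {X : C} (hX : compactObjects.{w} C X) : ∃ n : ℤ, t.le n X := by
  obtain ⟨G, hG, N, -, -, hN⟩ := ht
  -- Consider the sequence of truncations `τ^{≥ n} X`. The shifts of `G` are bounded above, so their
  -- maps to it are eventually zero. As `X` is compact, `X ⟶ τ^{≥ n} X` vanishes for some `n`, and
  -- `X` is a retract of `τ^{< n} X`.
  let E : ℕ ⥤ C :=
    { obj n := (t.truncGE n).obj X
      map {m n} f := (t.natTransTruncGEOfLE m n (by exact_mod_cast leOfHom f)).app X
      map_id n := t.natTransTruncGEOfLE_refl_app _ _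
      map_comp f g := (t.natTransTruncGEOfLE_trans_app _ _ _ _ _ _).symm }
  obtain ⟨n, hn⟩ := exists_map_eq_zero (E := E) hG hX (fun i ↦
    ⟨(N - i + 1).toNat, fun n hn f ↦ zero_of_le_of_ge t (m := N - i) (n := n) (by lia)
      (t.le_shift N i _ (by ring) _
        (hN _ (.of _ ⟨0, by simp, ⟨((shiftFunctorZero C ℤ).app G).symm⟩⟩)))
      ((t.ge_iff_isGE _ _).2 (inferInstanceAs (t.IsGE ((t.truncGE n).obj X) n))) f⟩)
    ((t.truncGEπ (0 : ℕ)).app X)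
  have hn' : (t.truncGEπ n).app X = 0 := by
    rw [← hn]
    exact (t.π_natTransTruncGEOfLE_app _ _ (by simp) X).symm
  obtain ⟨r⟩ := retract_of_distTriang_of_eq_zero (t.triangleLTGE_distinguished n X) hn'
  exact ⟨n - 1, le_of_retract t r
    ((t.le_iff_isLE _ _).2 (inferInstanceAs (t.IsLE ((t.truncLT n).obj X) (n - 1))))⟩

/-- Two t-structures in the preferred equivalence class are equivalent. -/
lemma exists_le_of_isPreferred [HasCoproducts.{w} C] {t t' : TStructure C}
    (ht : IsPreferred.{w} t) (ht' : IsPreferred.{w} t') :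
    ∃ c : ℕ, ∀ (k : ℤ) (X : C), t.le k X → t'.le (k + c) X := by
  obtain ⟨G, hG, N, -, hN, -⟩ := ht
  obtain ⟨n, hn⟩ := exists_le_of_compact ht' hG.compact
  refine ⟨(n + N).toNat, fun k X hX ↦ t'.le_monotone ?_ _
    (le_of_forall_shift (m := -N) (n := n) (fun X hX ↦
      le_of_coprod_shiftsIn t' hn (by simp) (hN X hX)) k hX)⟩
  lia

lemma ge_of_forall_le {t t' : TStructure C} {c : ℤ}
    (h : ∀ (k : ℤ) (X : C), t.le k X → t'.le (k + c) X) {k : ℤ} {X : C} (hX : t'.ge k X) :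
    t.ge (k - c) X := by
  rw [t.ge_iff_isGE, t.isGE_iff_orthogonal (k - c - 1) _ (by ring)]
  exact fun Y f hY ↦ zero_of_le_of_ge t' (by lia) (h _ Y hY.le) hX f

/-- The approximation property in the definition of the pseudo-compact objects does not depend on
the choice of the preferred t-structure. -/
lemma pseudoCompact_approximation [HasCoproducts.{w} C] {t : TStructure C}
    (ht : IsPreferred.{w} t) {F : C} (hF : pseudoCompactObjects.{w} C F) (n : ℤ) :
    Nonempty (Approximation t (compactObjects.{w} C) F n) := by
  obtain ⟨t', ht', h⟩ := hF
  obtain ⟨c, hc⟩ := exists_le_of_isPreferred ht' ht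
  obtain ⟨E, D, f, g, k, hT, hE, hD⟩ := h ((c - n).toNat + 1) (by lia)
  exact ⟨⟨E, D, f, g, k, hT, hE, t.le_monotone (by lia) _ (hc _ _ hD)⟩⟩

lemma pseudoCompactObjects_of_approximation {t : TStructure C} (ht : IsPreferred.{w} t) {F : C}
    (h : ∀ n : ℤ, Nonempty (Approximation t (compactObjects.{w} C) F n)) :
    pseudoCompactObjects.{w} C F :=
  ⟨t, ht, fun m _ ↦ (h (-m)).elim fun a ↦ ⟨a.E, a.D, a.f, a.g, a.h, a.dist, a.mem, a.le⟩⟩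

lemma pseudoCompactObjects_shift [HasCoproducts.{w} C] {F : C}
    (hF : pseudoCompactObjects.{w} C F) (i : ℤ) : pseudoCompactObjects.{w} C (F⟦i⟧) := by
  have hF' := hF
  obtain ⟨t, ht, -⟩ := hF'
  refine pseudoCompactObjects_of_approximation ht fun n ↦ ?_
  obtain ⟨a⟩ := pseudoCompact_approximation ht hF (n + i)
  exact ⟨⟨_, _, _, _, _, Triangle.shift_distinguished _ a.dist i, compactObjects_shift a.mem i,
    t.le_shift _ i n (by ring) _ a.le⟩⟩

lemma boundedPseudoCompactObjects_shift [HasCoproducts.{w} C] {F : C}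
    (hF : boundedPseudoCompactObjects.{w} C F) (i : ℤ) :
    boundedPseudoCompactObjects.{w} C (F⟦i⟧) := by
  obtain ⟨t, ht, h⟩ := hF.2
  exact ⟨pseudoCompactObjects_shift hF.1 i, t, ht, t.bounded.le_shift i _ h⟩

/-- Over a coherent weakly approximable category, a pseudo-compact object without maps to bounded
pseudo-compact objects is zero. -/
lemma isZero_of_leftOrthogonal [IsTriangulated C] (hC : IsWeaklyApproximable.{w} C)
    (hcoh : IsCoherent.{w} C) {X : C}
    (hX : (boundedPseudoCompactObjects.{w} C).leftOrthogonal X)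
    (hX' : pseudoCompactObjects.{w} C X) : IsZero X := by
  have := hC.hasCoproducts
  obtain ⟨A, G, t, hA, hG, hGA, ha, happ⟩ := hC.approx
  obtain ⟨N, -, hN⟩ := hcoh t (isPreferred_of_approx hA hG hGA ha happ)
  -- The point is that `N` does not depend on `i`.
  have hle (i : ℤ) : t.le N (X⟦i⟧) := by
    obtain ⟨Y, Z, f, g, h, hT, hY, hZ⟩ := hN _ (pseudoCompactObjects_shift hX' i)
    have hg : g = 0 := by
      let e := (shiftFunctorCompIsoId C i (-i) (by simp)).app X
      apply (shiftFunctor C (-i)).map_injective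
      rw [← cancel_epi e.inv, Functor.map_zero, comp_zero]
      exact hX _ (boundedPseudoCompactObjects_shift hZ.1 _)
    obtain ⟨r⟩ := retract_of_distTriang_of_eq_zero hT hg
    exact le_of_retract t r hY.2
  refine hG.generates X fun i f ↦ hom_shift_eq_zero t ha (m := -A - i) ?_ (by simp) f
  -- This shift turns the uniform bound `N` into `X ∈ t.le (-A - i)`, where `G⟦i⟧` has no maps to
  -- `X`.
  have := hle (-(N + A + i))
  rw [t.le_iff_isLE] at this ⊢
  exact t.isLE_of_shift X (-A - i) (-(N + A + i)) N (by ring)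

/-- The orthogonality statement for coherent weakly approximable categories. -/
lemma leftOrthogonal_inf_pseudoCompact_iff [IsTriangulated C] (hC : IsWeaklyApproximable.{w} C)
    (hcoh : IsCoherent.{w} C)
    (hc : compactObjects.{w} C ≤ boundedPseudoCompactObjects.{w} C) (X : C) :
    (boundedPseudoCompactObjects.{w} C).leftOrthogonal X ∧ pseudoCompactObjects.{w} C X ↔
      IsZero X :=
  ⟨fun h ↦ isZero_of_leftOrthogonal hC hcoh h.1 h.2,
    fun h ↦ ⟨fun _ _ _ ↦ h.eq_of_src _ _, (hc _ (compactObjects_of_isZero h)).1⟩⟩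

end Preferred

/-! ### Coproducts of complexes, computed degreewise. -/

section CoproductComplex

variable {A : Type u} [Category.{v} A] [Abelian A] {J : Type w}

/-- A family of cochain complexes, as a cochain complex in the category of families. -/
def familyComplex (K : J → CochainComplex A ℤ) : CochainComplex (Discrete J ⥤ A) ℤ where
  X i := Discrete.functor fun j ↦ (K j).X i
  d i k := Discrete.natTrans fun j ↦ (K j.as).d i k
  shape i k h := by ext ⟨j⟩; exact (K j).shape i k h
  d_comp_d' i k l _ _ := by ext ⟨j⟩; exact (K j).d_comp_d i k l

/-- The morphism between the complexes attached to two families. -/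
def familyMap {K L : J → CochainComplex A ℤ} (φ : ∀ j, K j ⟶ L j) :
    familyComplex K ⟶ familyComplex L where
  f i := Discrete.natTrans fun j ↦ (φ j.as).f i
  comm' i k _ := by ext ⟨j⟩; exact (φ j).comm i k

lemma quasiIso_familyMap {K L : J → CochainComplex A ℤ} (φ : ∀ j, K j ⟶ L j)
    [∀ j, QuasiIso (φ j)] : QuasiIso (familyMap φ) where
  quasiIsoAt i := by
    rw [quasiIsoAt_iff, ShortComplex.quasiIso_iff]
    rw [NatTrans.isIso_iff_isIso_app]
    rintro ⟨j⟩
    have h : IsIso (ShortComplex.homologyMap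
        ((HomologicalComplex.shortComplexFunctor A (.up ℤ) i).map (φ j))) := by
      rw [← ShortComplex.quasiIso_iff]
      exact (quasiIsoAt_iff (φ j) i).1 inferInstance
    exact (NatIso.isIso_map_iff (ShortComplex.homologyFunctorIso
      ((evaluation (Discrete J) A).obj ⟨j⟩)) _).1 h

variable [HasColimitsOfShape (Discrete J) A]

/-- The coproduct of a family of cochain complexes, computed degreewise. -/
noncomputable def coprodComplex (K : J → CochainComplex A ℤ) : CochainComplex A ℤ :=
  ((colim (J := Discrete J) (C := A)).mapHomologicalComplex _).obj (familyComplex K)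

/-- The inclusions into the coproduct. -/
noncomputable def coprodι (K : J → CochainComplex A ℤ) (j : J) : K j ⟶ coprodComplex K where
  f i := colimit.ι ((familyComplex K).X i) ⟨j⟩
  comm' i k _ := colimit.ι_map ((familyComplex K).d i k) ⟨j⟩

/-- The universal property of the coproduct. -/
noncomputable def coprodDesc {K : J → CochainComplex A ℤ} {L : CochainComplex A ℤ}
    (φ : ∀ j, K j ⟶ L) : coprodComplex K ⟶ L where
  f i := Sigma.desc (f := fun j ↦ (K j).X i) fun j ↦ (φ j).f i
  comm' i k _ := by
    refine Sigma.hom_ext (f := fun j ↦ (K j).X i) _ _ fun j ↦ ?_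
    refine (Sigma.ι_desc_assoc (f := fun j ↦ (K j).X i) _ _ _).trans (((φ j).comm i k).trans
      (Eq.symm ((colimit.ι_map_assoc ((familyComplex K).d i k) ⟨j⟩ _).trans ?_)))
    exact congrArg ((K j).d i k ≫ ·) (Sigma.ι_desc (f := fun j ↦ (K j).X k) _ _)

lemma coprodι_desc {K : J → CochainComplex A ℤ} {L : CochainComplex A ℤ}
    (φ : ∀ j, K j ⟶ L) (j : J) : coprodι K j ≫ coprodDesc φ = φ j := by
  ext i
  exact Sigma.ι_desc (f := fun j ↦ (K j).X i) _ _

lemma coprod_hom_ext {K : J → CochainComplex A ℤ} {L : CochainComplex A ℤ}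
    {f g : coprodComplex K ⟶ L} (h : ∀ j, coprodι K j ≫ f = coprodι K j ≫ g) : f = g := by
  ext i
  exact colimit.hom_ext fun ⟨j⟩ ↦ HomologicalComplex.congr_hom (h j) i

/-- Functoriality of the coproduct. -/
noncomputable def coprodMap {K L : J → CochainComplex A ℤ} (φ : ∀ j, K j ⟶ L j) :
    coprodComplex K ⟶ coprodComplex L :=
  coprodDesc fun j ↦ φ j ≫ coprodι L j

/-- This form lets exactness of coproducts apply: an exact functor applied degreewise preserves
quasi-isomorphisms. -/
lemma coprodMap_eq {K L : J → CochainComplex A ℤ} (φ : ∀ j, K j ⟶ L j) :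
    coprodMap φ = ((colim (J := Discrete J) (C := A)).mapHomologicalComplex _).map
      (familyMap φ) := by
  refine coprod_hom_ext fun j ↦ ?_
  rw [coprodMap, coprodι_desc]
  ext i
  exact (colimit.ι_map ((familyMap φ).f i) ⟨j⟩).symm

instance quasiIso_coprodMap [HasExactColimitsOfShape (Discrete J) A]
    {K L : J → CochainComplex A ℤ} (φ : ∀ j, K j ⟶ L j)
    [∀ j, QuasiIso (φ j)] : QuasiIso (coprodMap φ) := by
  have := quasiIso_familyMap φ
  have : (colim (J := Discrete J) (C := A)).PreservesHomology := inferInstance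
  have : (colim (J := Discrete J) (C := A)).Additive := inferInstance
  rw [coprodMap_eq]
  exact HomologicalComplex.quasiIso_map_of_preservesHomology _ _

end CoproductComplex

/-! ### Coproducts in the derived category. -/

section DerivedCoproducts

open DerivedCategory

variable {A : Type u} [Category.{v} A] [Abelian A] [HasDerivedCategory.{w} A]

/-- A morphism which vanishes in the derived category factors, up to a quasi-isomorphism,
through an acyclic complex. -/
lemma exists_factor_of_Q_map_eq_zero {K L : CochainComplex A ℤ} {f : K ⟶ L}
    (hf : Q.map f = 0) :
    ∃ (K' N : CochainComplex A ℤ) (s : K' ⟶ K) (_ : QuasiIso s) (a : K' ⟶ N) (b : N ⟶ L),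
      QuasiIso (0 : N ⟶ N) ∧ s ≫ f = a ≫ b := by
  have h0 : Qh.map ((HomotopyCategory.quotient A (.up ℤ)).map f) = Qh.map 0 := by
    rw [Functor.map_zero, ← cancel_epi ((quotientCompQhIso A).inv.app K),
      ← quotientCompQhIso_inv_naturality, hf, zero_comp, comp_zero]
  rw [MorphismProperty.map_eq_iff_precomp Qh (HomotopyCategory.quasiIso A (.up ℤ))] at h0
  obtain ⟨X', s, hs, h⟩ := h0
  obtain ⟨X', rfl⟩ := HomotopyCategory.quotient_obj_surjective X'
  obtain ⟨s, rfl⟩ := (HomotopyCategory.quotient _ _).map_surjective s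
  rw [← isIso_Qh_map_iff] at hs
  replace hs : QuasiIso s := (isIso_Q_map_iff_quasiIso (C := A) s).1 hs
  rw [comp_zero, ← Functor.map_comp, ← Functor.map_zero (HomotopyCategory.quotient A (.up ℤ))] at h
  have H := HomotopyCategory.homotopyOfEq _ _ h
  -- A null-homotopy of `s ≫ f` is the same as an extension of `s ≫ f` to the cone of the identity,
  -- which is acyclic.
  refine ⟨X', CochainComplex.mappingCone (𝟙 X'), s, hs, CochainComplex.mappingCone.inr _,
    CochainComplex.mappingCone.desc (𝟙 X') (CochainComplex.HomComplex.Cochain.ofHomotopy H)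
      (s ≫ f) (by simp), ?_, by simp⟩
  rw [← isIso_Q_map_iff_quasiIso]
  have hz : IsZero (Q.obj (CochainComplex.mappingCone (𝟙 X'))) := by
    have := mappingCone_triangle_distinguished (𝟙 X')
    refine (Triangle.isZero₃_iff_isIso₁ _ this).2 ?_
    exact inferInstanceAs (IsIso (Q.map (𝟙 X')))
  exact ⟨⟨0, hz.eq_of_src _ _, hz.eq_of_src _ _⟩⟩

variable {J : Type*} [HasColimitsOfShape (Discrete J) A] [HasExactColimitsOfShape (Discrete J) A]

/-- Coproducts in the derived category are computed by coproducts of complexes. -/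
noncomputable def isColimitCoprod (K : J → CochainComplex A ℤ) :
    IsColimit (Cofan.mk (Q.obj (coprodComplex K)) fun j ↦ Q.map (coprodι K j)) := by
  -- Uniqueness: `h` is a fraction with numerator `g`. Each restriction of `g` factors, up to a
  -- quasi-isomorphism, through an acyclic complex `N j`. Coproducts preserve quasi-isomorphisms and
  -- acyclicity, so `g` itself vanishes in the derived category.
  have hinj {Y : DerivedCategory A} (h : Q.obj (coprodComplex K) ⟶ Y)
      (hh : ∀ j, Q.map (coprodι K j) ≫ h = 0) : h = 0 := by
    obtain ⟨L, ⟨e⟩⟩ : ∃ L, Nonempty (Y ≅ Q.obj L) := ⟨_, ⟨(Q.objObjPreimageIso Y).symm⟩⟩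
    rw [← cancel_mono e.hom, zero_comp]
    obtain ⟨L', g, s, hs, hg⟩ := left_fac (h ≫ e.hom)
    rw [hg]
    have hg' (j : J) : Q.map (coprodι K j ≫ g) = 0 := by
      rw [Functor.map_comp, ← cancel_mono (inv (Q.map s)), Category.assoc, ← hg, reassoc_of% hh j,
        zero_comp, zero_comp]
    choose K' N t ht a b hN hab using fun j ↦ exists_factor_of_Q_map_eq_zero (hg' j)
    have hfac : coprodMap t ≫ g = coprodMap a ≫ coprodDesc b := by
      refine coprod_hom_ext fun j ↦ ?_
      rw [coprodMap, coprodMap, ← Category.assoc, ← Category.assoc, coprodι_desc, coprodι_desc,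
        Category.assoc, Category.assoc, coprodι_desc, hab]
    -- Acyclicity of `N j` is expressed by its zero endomorphism being a quasi-isomorphism. The
    -- coproduct of these maps is both zero and invertible.
    have hz : Q.map (coprodMap fun j ↦ (0 : N j ⟶ N j)) = 0 := by
      rw [← Q.map_zero]
      congr 1
      exact coprod_hom_ext fun j ↦ by rw [coprodMap, coprodι_desc, zero_comp, comp_zero]
    have hz' : IsIso (Q.map (coprodMap fun j ↦ (0 : N j ⟶ N j))) := by
      rw [isIso_Q_map_iff_quasiIso]
      infer_instance
    have : Q.map g = 0 := by
      have : IsIso (Q.map (coprodMap t)) := by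
        rw [isIso_Q_map_iff_quasiIso]
        infer_instance
      rw [← cancel_epi (Q.map (coprodMap t)), ← Functor.map_comp, hfac, Functor.map_comp,
        comp_zero]
      rw [hz] at hz'
      obtain ⟨k, hk, -⟩ := hz'.out
      rw [← Category.comp_id (Q.map (coprodMap a)), ← hk, zero_comp, comp_zero, zero_comp]
    rw [this, zero_comp]
  -- Existence: each `f j` is a fraction with denominator `s j` on the source side; the coproduct of
  -- the denominators is again a quasi-isomorphism.
  have hex {Y : DerivedCategory A} (f : ∀ j, Q.obj (K j) ⟶ Y) :
      ∃ h : Q.obj (coprodComplex K) ⟶ Y, ∀ j, Q.map (coprodι K j) ≫ h = f j := by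
    obtain ⟨L, ⟨e⟩⟩ : ∃ L, Nonempty (Y ≅ Q.obj L) := ⟨_, ⟨(Q.objObjPreimageIso Y).symm⟩⟩
    choose K' s hs g hg using fun j ↦ right_fac (f j ≫ e.hom)
    have hs' (j : J) : QuasiIso (s j) := by
      rw [← isIso_Q_map_iff_quasiIso]
      exact hs j
    refine ⟨inv (Q.map (coprodMap s)) ≫ Q.map (coprodDesc g) ≫ e.inv, fun j ↦ ?_⟩
    rw [← cancel_epi (Q.map (s j)), ← Functor.map_comp_assoc]
    have : s j ≫ coprodι K j = coprodι K' j ≫ coprodMap s := by rw [coprodMap, coprodι_desc]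
    rw [this, Functor.map_comp_assoc, IsIso.hom_inv_id_assoc, ← Functor.map_comp_assoc,
      coprodι_desc, ← cancel_mono e.hom, Category.assoc, Category.assoc, e.inv_hom_id,
      Category.comp_id, hg, IsIso.hom_inv_id_assoc]
  choose d hd using fun (Y : DerivedCategory A) (f : ∀ j, Q.obj (K j) ⟶ Y) ↦ hex f
  refine Cofan.IsColimit.mk _ (fun c ↦ d c.pt c.inj) (fun c j ↦ hd _ _ j) fun c m hm ↦ ?_
  rw [← sub_eq_zero]
  refine hinj _ fun j ↦ ?_
  rw [Preadditive.comp_sub, hd, sub_eq_zero]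
  exact hm j

lemma hasCoproductsOfShape_derivedCategory :
    HasColimitsOfShape (Discrete J) (DerivedCategory A) := by
  refine ⟨fun F ↦ ?_⟩
  let e (j : J) : F.obj ⟨j⟩ ≅ Q.obj (Q.objPreimage (F.obj ⟨j⟩)) := (Q.objObjPreimageIso _).symm
  have : HasColimit (Discrete.functor fun j : J ↦ Q.obj (Q.objPreimage (F.obj ⟨j⟩))) :=
    ⟨⟨_, isColimitCoprod fun j ↦ Q.objPreimage (F.obj ⟨j⟩)⟩⟩
  exact hasColimit_of_iso
    (F := Discrete.functor fun j : J ↦ Q.obj (Q.objPreimage (F.obj ⟨j⟩)))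
    (Discrete.natIso fun ⟨j⟩ ↦ e j)

end DerivedCoproducts

/-! ### Morphisms from projective complexes. -/

section Projective

open DerivedCategory

variable {A : Type u} [Category.{v} A] [Abelian A] [HasDerivedCategory.{w} A]

/-- Morphisms in the derived category from a K-projective complex come from morphisms of
complexes. -/
lemma exists_Q_map_eq {K L : CochainComplex A ℤ} [K.IsKProjective] (f : Q.obj K ⟶ Q.obj L) :
    ∃ g : K ⟶ L, f = Q.map g := by
  obtain ⟨g, hg⟩ := (CochainComplex.IsKProjective.Qh_map_bijective K
    ((HomotopyCategory.quotient A (.up ℤ)).obj L)).surjective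
      ((quotientCompQhIso A).hom.app K ≫ f ≫ (quotientCompQhIso A).inv.app L)
  obtain ⟨g, rfl⟩ := (HomotopyCategory.quotient _ _).map_surjective g
  refine ⟨g, ?_⟩
  rw [← cancel_epi ((quotientCompQhIso A).hom.app K),
    ← cancel_mono ((quotientCompQhIso A).inv.app L), Category.assoc, ← hg, Category.assoc,
    quotientCompQhIso_inv_naturality, Iso.hom_inv_id_app_assoc]

/-- The map is represented by a map of complexes whose source and target have no common nonzero
degree. -/
lemma hom_eq_zero_of_isStrictlyGE {K : CochainComplex A ℤ} [K.IsKProjective] {m n : ℤ}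
    [K.IsStrictlyGE n] (h : m < n) {X : DerivedCategory A} (hX : TStructure.t.le m X)
    (f : Q.obj K ⟶ X) : f = 0 := by
  obtain ⟨L, e, hL⟩ := hX
  rw [← cancel_mono e.hom, zero_comp]
  obtain ⟨g, hg⟩ := exists_Q_map_eq (f ≫ e.hom)
  have : g = 0 := by
    ext i
    by_cases hi : i < n
    · exact (K.isZero_of_isStrictlyGE n i hi).eq_of_src _ _
    · exact (L.isZero_of_isStrictlyLE m i (by lia)).eq_of_tgt _ _
  rw [hg, this, Q.map_zero]

instance isKProjective_single (P : A) [Projective P] (n : ℤ) :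
    CochainComplex.IsKProjective ((HomologicalComplex.single A (.up ℤ) n).obj P) := by
  have (i : ℤ) : Projective (((HomologicalComplex.single A (.up ℤ) n).obj P).X i) := by
    by_cases h : i = n
    · subst h
      exact Projective.of_iso (HomologicalComplex.singleObjXSelf (.up ℤ) i P).symm inferInstance
    · exact Projective.of_iso
        (HomologicalComplex.isZero_single_obj_X (.up ℤ) n P i h).isoZero.symm inferInstance
  have : CochainComplex.IsStrictlyLE ((HomologicalComplex.single A (.up ℤ) n).obj P) n :=
    inferInstanceAs (CochainComplex.IsStrictlyLE ((CochainComplex.singleFunctor A n).obj P) n)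
  exact CochainComplex.isKProjective_of_projective _ n

lemma single_hom_eq_zero {P : A} [Projective P] {m : ℤ} (h : m < 0) {X : DerivedCategory A}
    (hX : TStructure.t.le m X) (f : (singleFunctor A 0).obj P ⟶ X) : f = 0 := by
  have : CochainComplex.IsStrictlyGE ((HomologicalComplex.single A (.up ℤ) 0).obj P) 0 :=
    inferInstanceAs (CochainComplex.IsStrictlyGE ((CochainComplex.singleFunctor A 0).obj P) 0)
  exact hom_eq_zero_of_isStrictlyGE (K := (HomologicalComplex.single A (.up ℤ) 0).obj P) h hX f

/-- The cohomology of the object of the derived category given by a complex. -/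
noncomputable def homologyQIso (K : CochainComplex A ℤ) (n : ℤ) :
    (homologyFunctor A n).obj (Q.obj K) ≅ K.homology n :=
  (homologyFunctorFactors A n).app K

lemma homologyQIso_inv_naturality {K L : CochainComplex A ℤ} (f : K ⟶ L) (n : ℤ) :
    (homologyQIso K n).inv ≫ (homologyFunctor A n).map (Q.map f) =
      HomologicalComplex.homologyMap f n ≫ (homologyQIso L n).inv :=
  ((homologyFunctorFactors A n).inv.naturality f).symm

/-- Morphisms from a projective object to the cohomology in degree zero are induced by morphisms
in the derived category. -/
lemma exists_single_hom {P : A} [Projective P] {X : DerivedCategory A}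
    (φ : P ⟶ (homologyFunctor A 0).obj X) :
    ∃ (θ : P ⟶ (homologyFunctor A 0).obj ((singleFunctor A 0).obj P))
      (f : (singleFunctor A 0).obj P ⟶ X), θ ≫ (homologyFunctor A 0).map f = φ := by
  obtain ⟨L, ⟨e⟩⟩ : ∃ L, Nonempty (Q.obj L ≅ X) := ⟨_, ⟨Q.objObjPreimageIso X⟩⟩
  let S : CochainComplex A ℤ := (HomologicalComplex.single A (.up ℤ) 0).obj P
  let ψ : P ⟶ L.homology 0 := φ ≫ (homologyFunctor A 0).map e.inv ≫ (homologyQIso L 0).hom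
  -- Projectivity lifts the map from cohomology to cycles, and a map to the cycles is a map of
  -- complexes from `P` in degree zero.
  let a : P ⟶ L.cycles 0 := Projective.factorThru ψ (L.homologyπ 0)
  have ha : a ≫ L.homologyπ 0 = φ ≫ (homologyFunctor A 0).map e.inv ≫ (homologyQIso L 0).hom :=
    Projective.factorThru_comp ψ (L.homologyπ 0)
  let F : S ⟶ L := HomologicalComplex.mkHomFromSingle (a ≫ L.iCycles 0) (by simp)
  have hF : F.f 0 = (HomologicalComplex.singleObjXSelf (.up ℤ) 0 P).hom ≫ a ≫ L.iCycles 0 :=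
    HomologicalComplex.mkHomFromSingle_f _ _
  let z : P ⟶ S.cycles 0 := S.liftCycles (HomologicalComplex.singleObjXSelf (.up ℤ) 0 P).inv 1
    (by simp) (by simp [S])
  have hz : z ≫ HomologicalComplex.cyclesMap F 0 = a := by
    rw [← cancel_mono (L.iCycles 0), Category.assoc, HomologicalComplex.cyclesMap_i,
      HomologicalComplex.liftCycles_i_assoc, hF, Iso.inv_hom_id_assoc]
  have key : (z ≫ S.homologyπ 0 ≫ (homologyQIso S 0).inv) ≫
      (homologyFunctor A 0).map (Q.map F ≫ e.hom) = φ := by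
    rw [Functor.map_comp, Category.assoc, Category.assoc,
      reassoc_of% homologyQIso_inv_naturality F 0, HomologicalComplex.homologyπ_naturality_assoc,
      reassoc_of% hz, reassoc_of% ha, Iso.hom_inv_id_assoc, ← Functor.map_comp, e.inv_hom_id,
      CategoryTheory.Functor.map_id, Category.comp_id]
  exact ⟨_, _, key⟩

end Projective

/-! ### Maps from the ring to a direct sum of modules. -/

section ModuleCompact

open scoped DirectSum

variable {R : Type u} [Ring R] {J : Type u} (Z : J → ModuleCat.{u} R)

/-- The map is determined by the image of `1`, an element of a direct sum, which has finite support.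
-/
lemma mem_range_sigmaHom_module (f : ModuleCat.of R R ⟶ ∐ Z) :
    f ∈ (sigmaHom (Cofan.mk (∐ Z) (Sigma.ι Z)) (ModuleCat.of R R)).range := by
  classical
  have key (x : ⨁ j, Z j) : ModuleCat.ofHom (LinearMap.toSpanSingleton R _ x) ≫
      (ModuleCat.coprodIsoDirectSum Z).inv ∈
        (sigmaHom (Cofan.mk (∐ Z) (Sigma.ι Z)) (ModuleCat.of R R)).range := by
    induction x using DirectSum.induction_on with
    | zero =>
      have : ModuleCat.ofHom (LinearMap.toSpanSingleton R (⨁ j, Z j) 0) = 0 := by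
        ext; simp
      rw [this, zero_comp]
      exact zero_mem _
    | of j z =>
      have : ModuleCat.ofHom (LinearMap.toSpanSingleton R (⨁ j, Z j)
          (DirectSum.of (fun j ↦ Z j) j z)) = ModuleCat.ofHom (LinearMap.toSpanSingleton R _ z) ≫
            ModuleCat.ofHom (DirectSum.lof R J (fun i ↦ Z i) j) := by
        ext; simp [DirectSum.lof_eq_of]
      rw [this, Category.assoc, ModuleCat.lof_coprodIsoDirectSum_inv]
      exact comp_inj_mem_range (c := Cofan.mk (∐ Z) (Sigma.ι Z)) j _
    | add x y hx hy =>
      have : ModuleCat.ofHom (LinearMap.toSpanSingleton R (⨁ j, Z j) (x + y)) =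
          ModuleCat.ofHom (LinearMap.toSpanSingleton R _ x) +
            ModuleCat.ofHom (LinearMap.toSpanSingleton R _ y) := by
        ext; simp
      rw [this, Preadditive.add_comp]
      exact add_mem hx hy
  have : f = ModuleCat.ofHom (LinearMap.toSpanSingleton R _
      ((ModuleCat.coprodIsoDirectSum Z).hom (f (1 : R)))) ≫
        (ModuleCat.coprodIsoDirectSum Z).inv :=
    (Iso.eq_comp_inv (ModuleCat.coprodIsoDirectSum Z)).2
      (ModuleCat.hom_ext (LinearMap.ext_ring (one_smul R _).symm))
  rw [this]
  exact key _

end ModuleCompact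

/-! ### The ring as a compact generator. -/

section RingObject

open DerivedCategory

variable (R : Type u) [Ring R] [HasDerivedCategory.{w} (ModuleCat.{u} R)]

/-- The ring, as a complex in degree zero, in the derived category of left modules. -/
noncomputable abbrev ringObj : DerivedCategory (ModuleCat.{u} R) :=
  (singleFunctor (ModuleCat.{u} R) 0).obj (ModuleCat.of R R)

instance : HasCoproducts.{u} (DerivedCategory (ModuleCat.{u} R)) :=
  fun _ ↦ hasCoproductsOfShape_derivedCategory


variable {R} in
/-- The projections from a coproduct of complexes. -/
noncomputable def coprodπ {J : Type u} (K : J → CochainComplex (ModuleCat.{u} R) ℤ) (j : J) :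
    coprodComplex K ⟶ K j := by
  classical
  exact coprodDesc fun i ↦ if h : i = j then eqToHom (by rw [h]) else 0

omit [HasDerivedCategory.{w} (ModuleCat.{u} R)] in
variable {R} in
lemma coprodπ_f {J : Type u} (K : J → CochainComplex (ModuleCat.{u} R) ℤ) (j : J) (n : ℤ) :
    (coprodπ K j).f n = cofanProj (c := Cofan.mk (∐ fun j ↦ (K j).X n) (Sigma.ι _))
      (coproductIsCoproduct _) j := by
  classical
  refine Cofan.IsColimit.hom_ext (coproductIsCoproduct _) _ _ fun i ↦ ?_
  have h1 : (coprodι K i).f n ≫ (coprodπ K j).f n = (coprodι K i ≫ coprodπ K j).f n := rfl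
  refine h1.trans ?_
  rw [coprodπ, coprodι_desc]
  by_cases h : i = j
  · subst h
    rw [inj_cofanProj_self, dif_pos rfl]
    rfl
  · rw [inj_cofanProj_of_ne _ h, dif_neg h]
    rfl

variable {R} in
omit [HasDerivedCategory.{w} (ModuleCat.{u} R)] in
lemma exists_finset_single_eq_sum {J : Type u} {K : J → CochainComplex (ModuleCat.{u} R) ℤ}
    (g : (HomologicalComplex.single _ (.up ℤ) 0).obj (ModuleCat.of R R) ⟶ coprodComplex K) :
    ∃ s : Finset J, g = ∑ j ∈ s, (g ≫ coprodπ K j) ≫ coprodι K j := by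
  let e := HomologicalComplex.singleObjXSelf (.up ℤ) 0 (ModuleCat.of R R)
  obtain ⟨s, hs⟩ := eq_sum_of_mem_range (coproductIsCoproduct _)
    (mem_range_sigmaHom_module (fun j ↦ (K j).X 0) (e.inv ≫ g.f 0))
  refine ⟨s, HomologicalComplex.from_single_hom_ext ?_⟩
  rw [← cancel_epi e.inv]
  have hsum (G : J → ((HomologicalComplex.single _ (.up ℤ) 0).obj (ModuleCat.of R R) ⟶
      coprodComplex K)) : (∑ j ∈ s, G j).f 0 = ∑ j ∈ s, (G j).f 0 :=
    map_sum (HomologicalComplex.Hom.fAddMonoidHom 0) G s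
  refine hs.trans (Eq.symm ?_)
  rw [hsum, Preadditive.comp_sum]
  refine Finset.sum_congr rfl fun j _ ↦ ?_
  rw [← coprodπ_f]
  exact ((Category.assoc _ _ _).symm.trans (congrArg (· ≫ _) (Category.assoc _ _ _).symm))

variable {R} in
lemma mem_range_of_iso {C : Type u} [Category.{v} C] [Preadditive C] {J : Type w} {F G : J → C}
    (e : ∀ j, F j ≅ G j)
    {c : Cofan F} {d : Cofan G} (φ : d.pt ≅ c.pt) (h : ∀ j, d.inj j ≫ φ.hom = (e j).inv ≫ c.inj j)
    {X : C} {f : X ⟶ d.pt} (hf : f ∈ (sigmaHom d X).range) :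
    f ≫ φ.hom ∈ (sigmaHom c X).range := by
  have := sigmaHom_range_le ((sigmaHom c X).range.comap (Preadditive.rightComp X φ.hom))
    (fun j g ↦ by
      change (g ≫ d.inj j) ≫ φ.hom ∈ (sigmaHom c X).range
      rw [Category.assoc, h, ← Category.assoc]
      exact comp_inj_mem_range j _) hf
  exact this

/-- The ring in degree zero is K-projective, so a map to a coproduct is represented by a map of
complexes. That map is determined by its degree zero part, which meets finitely many summands. -/
lemma compact_ringObj : compactObjects.{u} _ (ringObj R) := by
  rw [compactObjects_iff]
  intro J F c hc f
  let K (j : J) := Q.objPreimage (F j)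
  let e (j : J) : Q.obj (K j) ≅ F j := Q.objObjPreimageIso (F j)
  let hd := isColimitCoprod K
  let φ : Q.obj (coprodComplex K) ≅ c.pt :=
    { hom := Cofan.IsColimit.desc hd fun j ↦ (e j).hom ≫ c.inj j
      inv := Cofan.IsColimit.desc hc fun j ↦ (e j).inv ≫ Q.map (coprodι K j)
      hom_inv_id := Cofan.IsColimit.hom_ext hd _ _ fun j ↦ by
        rw [Cofan.IsColimit.fac_assoc, Category.assoc, Cofan.IsColimit.fac]
        exact ((e j).hom_inv_id_assoc _).trans (Category.comp_id _).symm
      inv_hom_id := Cofan.IsColimit.hom_ext hc _ _ fun j ↦ by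
        rw [Cofan.IsColimit.fac_assoc, Category.assoc]
        refine (congrArg ((e j).inv ≫ ·) (Cofan.IsColimit.fac hd _ j)).trans ?_
        exact ((e j).inv_hom_id_assoc _).trans (Category.comp_id _).symm }
  obtain ⟨g, hg⟩ := exists_Q_map_eq
    (K := (HomologicalComplex.single _ (.up ℤ) 0).obj (ModuleCat.of R R)) (f ≫ φ.inv)
  obtain ⟨s, hs⟩ := exists_finset_single_eq_sum g
  have hf : f = Q.map g ≫ φ.hom := (Iso.comp_inv_eq φ).1 hg
  rw [hf]
  refine mem_range_of_iso (d := Cofan.mk (Q.obj (coprodComplex K)) fun j ↦ Q.map (coprodι K j))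
    (fun j ↦ (e j).symm) φ (fun j ↦ Cofan.IsColimit.fac hd _ j) ?_
  rw [hs, Q.map_sum]
  refine sum_mem fun j _ ↦ ?_
  rw [Q.map_comp]
  exact comp_inj_mem_range
    (c := Cofan.mk (Q.obj (coprodComplex K)) fun j ↦ Q.map (coprodι K j)) j _

lemma isZero_of_homology {A : Type u} [Category.{v} A] [Abelian A] [HasDerivedCategory.{w} A]
    {X : DerivedCategory A} (h : ∀ n, IsZero ((homologyFunctor A n).obj X)) : IsZero X := by
  have h₁ : X.IsLE 0 := (isLE_iff X 0).2 fun i _ ↦ h i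
  have h₂ : X.IsGE 1 := (isGE_iff X 1).2 fun i _ ↦ h i
  rw [IsZero.iff_id_eq_zero]
  exact zero_of_le_of_ge TStructure.t (by lia) h₁.le h₂.ge _

/-- The cohomology of a shift. -/
noncomputable def homologyShiftIso {A : Type u} [Category.{v} A] [Abelian A]
    [HasDerivedCategory.{w} A] (X : DerivedCategory A) (a n m : ℤ) (h : a + n = m) :
    (homologyFunctor A n).obj (X⟦a⟧) ≅ (homologyFunctor A m).obj X :=
  ((homologyFunctor A 0).shiftIso a n m h).app X

lemma isCompactGenerator_ringObj : IsCompactGenerator.{u} (ringObj R) where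
  compact := compact_ringObj R
  generates X hX := by
    refine isZero_of_homology fun n ↦ ?_
    -- Every element of `H^n(X) = H^0(X⟦n⟧)` is induced by such an `f`.
    have h0 (f : ringObj R ⟶ X⟦n⟧) : f = 0 := by
      let e := (shiftFunctorCompIsoId (DerivedCategory (ModuleCat.{u} R)) n (-n) (by simp)).app X
      apply (shiftFunctor _ (-n)).map_injective
      rw [← cancel_mono e.hom, Functor.map_zero, zero_comp]
      exact hX _ _
    refine IsZero.of_iso ?_ (homologyShiftIso X n 0 n (by simp)).symm
    have : Subsingleton ((homologyFunctor (ModuleCat.{u} R) 0).obj (X⟦n⟧)) := by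
      refine ⟨fun x y ↦ ?_⟩
      have key (x : (homologyFunctor (ModuleCat.{u} R) 0).obj (X⟦n⟧)) : x = 0 := by
        obtain ⟨θ, f, hf⟩ := exists_single_hom (P := ModuleCat.of R R)
          (ModuleCat.ofHom (LinearMap.toSpanSingleton R _ x))
        rw [h0 f, Functor.map_zero, comp_zero] at hf
        simpa using (congrArg (fun φ ↦ φ.hom (1 : R)) hf).symm
      rw [key x, key y]
    exact ModuleCat.isZero_of_subsingleton _

end RingObject

/-! ### Weak approximability of the derived category. -/

section RingApproximable

open DerivedCategory

/-- In the long exact sequence, the top cohomology of the cone sits between the zero map out of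
`H^n(Y)` and `H^{n+1}(X) = 0`. -/
lemma le_of_epi_homology {A : Type u} [Category.{v} A] [Abelian A] [HasDerivedCategory.{w} A]
    {X Y Z : DerivedCategory A} {f : X ⟶ Y} {g : Y ⟶ Z} {h : Z ⟶ X⟦(1 : ℤ)⟧}
    (hT : Triangle.mk f g h ∈ distTriang _) {n : ℤ} (hX : TStructure.t.le n X)
    (hY : TStructure.t.le n Y) (hf : Epi ((homologyFunctor A n).map f)) :
    TStructure.t.le (n - 1) Z := by
  have : X.IsLE n := ⟨hX⟩
  have : Y.IsLE n := ⟨hY⟩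
  refine ((isLE_iff Z (n - 1)).2 fun i hi ↦ ?_).le
  refine (HomologySequence.exact₃ _ hT i (i + 1)).isZero_X₂ ?_
    ((isZero_of_isLE X n (i + 1) (by lia)).eq_of_tgt _ _)
  by_cases h : i = n
  · subst h
    exact (HomologySequence.epi_homologyMap_mor₁_iff _ hT i).1 hf
  · exact (isZero_of_isLE Y n i (by lia)).eq_of_src _ _

variable (R : Type u) [Ring R] [HasDerivedCategory.{w} (ModuleCat.{u} R)]

lemma le_zero_ringObj : TStructure.t.le 0 (ringObj R) :=
  (inferInstance : ((singleFunctor (ModuleCat.{u} R) 0).obj (ModuleCat.of R R)).IsLE 0).le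

variable {R}

/-- An element of the cohomology in degree zero comes from a morphism from the ring. -/
lemma exists_ringObj_hom {X : DerivedCategory (ModuleCat.{u} R)}
    (x : (homologyFunctor (ModuleCat.{u} R) 0).obj X) :
    ∃ (f : ringObj R ⟶ X) (z : (homologyFunctor (ModuleCat.{u} R) 0).obj (ringObj R)),
      (homologyFunctor (ModuleCat.{u} R) 0).map f z = x := by
  obtain ⟨θ, f, hf⟩ := exists_single_hom (P := ModuleCat.of R R)
    (ModuleCat.ofHom (LinearMap.toSpanSingleton R _ x))
  refine ⟨f, θ (1 : R), ?_⟩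
  simpa using congrArg (fun φ ↦ φ.hom (1 : R)) hf

lemma hom_ringObj_eq_zero {X : DerivedCategory (ModuleCat.{u} R)} (hX : TStructure.t.le (-1) X)
    (f : ringObj R ⟶ X) : f = 0 :=
  single_hom_eq_zero (by simp) hX f

/-- An object with cohomology in nonpositive degrees receives a morphism from a coproduct of
copies of the ring that is surjective on the cohomology in degree zero. -/
lemma exists_ringObj_approximation {F : DerivedCategory (ModuleCat.{u} R)}
    (hF : TStructure.t.le 0 F) :
    ∃ (J : Type u) (D : DerivedCategory (ModuleCat.{u} R))
      (f : (∐ fun _ : J ↦ ringObj R) ⟶ F) (g : F ⟶ D)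
      (h : D ⟶ (∐ fun _ : J ↦ ringObj R)⟦(1 : ℤ)⟧),
      Triangle.mk f g h ∈ distTriang _ ∧ TStructure.t.le (-1) D := by
  choose φ z hφ using fun x ↦ exists_ringObj_hom (X := F) x
  let f : (∐ fun _ ↦ ringObj R) ⟶ F := Sigma.desc φ
  obtain ⟨D, g, h, hT⟩ := distinguished_cocone_triangle f
  refine ⟨_, D, f, g, h, hT, ?_⟩
  have hE : TStructure.t.le 0 (∐ fun _ : (homologyFunctor (ModuleCat.{u} R) 0).obj F ↦ ringObj R) :=
    le_of_coprod.{u} (P := fun X ↦ X = ringObj R) _ (by rintro _ rfl; exact le_zero_ringObj R)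
      (.coproduct _ _ (coproductIsCoproduct _) fun _ ↦ .of _ rfl)
  refine le_of_epi_homology hT hE hF ((ModuleCat.epi_iff_surjective _).2 fun x ↦ ?_)
  refine ⟨(homologyFunctor (ModuleCat.{u} R) 0).map (Sigma.ι (fun _ ↦ ringObj R) x) (z x), ?_⟩
  rw [← ModuleCat.comp_apply, ← Functor.map_comp]
  have : Sigma.ι (fun _ ↦ ringObj R) x ≫ f = φ x := Sigma.ι_desc _ _
  rw [this, hφ]

variable (R) in
-- These data serve twice: for weak approximability, and to show that this very t-structure is
-- preferred.
lemma weaklyApproximable_data : TStructure.t.le (1 : ℕ) (ringObj R) ∧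
    (∀ X : DerivedCategory (ModuleCat.{u} R), TStructure.t.le (-(1 : ℕ)) X →
      ∀ f : ringObj R ⟶ X, f = 0) ∧
    ∀ F : DerivedCategory (ModuleCat.{u} R), TStructure.t.le 0 F →
      ∃ (E D : DerivedCategory (ModuleCat.{u} R)) (f : E ⟶ F) (g : F ⟶ D)
        (h : D ⟶ E⟦(1 : ℤ)⟧), Triangle.mk f g h ∈ distTriang _ ∧
          genInterval.{u} (ringObj R) (-(1 : ℕ)) (1 : ℕ) E ∧ TStructure.t.le (-1) D := by
  refine ⟨TStructure.t.le_monotone (by simp) _ (le_zero_ringObj R),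
    fun X hX f ↦ hom_ringObj_eq_zero hX f, fun F hF ↦ ?_⟩
  obtain ⟨J, D, f, g, h, hT, hD⟩ := exists_ringObj_approximation hF
  exact ⟨_, D, f, g, h, hT, ⟨_, .coproduct _ _ (coproductIsCoproduct _) fun _ ↦
    .of _ ⟨0, by simp, ⟨((shiftFunctorZero _ ℤ).app _).symm⟩⟩, ⟨Retract.refl _⟩⟩, hD⟩

variable (R)

theorem isWeaklyApproximable_derivedCategory :
    IsWeaklyApproximable.{u} (DerivedCategory (ModuleCat.{u} R)) where
  hasCoproducts := inferInstance
  approx := ⟨1, ringObj R, TStructure.t, one_pos, isCompactGenerator_ringObj R,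
    weaklyApproximable_data R⟩

lemma isPreferred_t :
    IsPreferred.{u} (TStructure.t : TStructure (DerivedCategory (ModuleCat.{u} R))) :=
  isPreferred_of_approx one_pos (isCompactGenerator_ringObj R) (weaklyApproximable_data R).1
    (weaklyApproximable_data R).2.1 (weaklyApproximable_data R).2.2

end RingApproximable

/-! ### Finitely presented modules over a coherent ring. -/

section CoherentRings

variable {R : Type u} [Ring R]

lemma finitePresentation_of_injective {M X : Type u} [AddCommGroup M] [Module R M]
    [AddCommGroup X] [Module R X] [Module.Finite R X]
    (hM : ∀ N : Submodule R M, N.FG → Module.FinitePresentation R N)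
    {i : X →ₗ[R] M} (hi : Function.Injective i) : Module.FinitePresentation R X := by
  have := hM (LinearMap.range i) (Submodule.fg_range i)
  exact (LinearEquiv.finitePresentation_iff (LinearEquiv.ofInjective i hi)).2 this

/-- The image of `X` in `N` is finitely generated, hence finitely presented, so the kernel is
finitely generated. The kernel embeds in `M`, hence is finitely presented too, and `X` is an
extension of the two. -/
lemma finitePresentation_of_injective_prod {M N X : Type u} [AddCommGroup M] [Module R M]
    [AddCommGroup N] [Module R N] [AddCommGroup X] [Module R X] [Module.Finite R X]
    (hM : ∀ P : Submodule R M, P.FG → Module.FinitePresentation R P)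
    (hN : ∀ P : Submodule R N, P.FG → Module.FinitePresentation R P)
    {i : X →ₗ[R] M × N} (hi : Function.Injective i) : Module.FinitePresentation R X := by
  let p : X →ₗ[R] N := LinearMap.snd R M N ∘ₗ i
  have h₁ : Module.FinitePresentation R (LinearMap.range p) := hN _ (Submodule.fg_range p)
  have h₂ : (LinearMap.ker p.rangeRestrict).FG :=
    Module.FinitePresentation.fg_ker _ p.surjective_rangeRestrict
  have : Module.Finite R (LinearMap.ker p.rangeRestrict) := Module.Finite.iff_fg.2 h₂
  have h₃ : Module.FinitePresentation R (LinearMap.ker p.rangeRestrict) :=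
    finitePresentation_of_injective hM
      (i := LinearMap.fst R M N ∘ₗ i ∘ₗ (LinearMap.ker p.rangeRestrict).subtype) (by
        rw [injective_iff_map_eq_zero]
        rintro ⟨x, hx⟩ h
        have hx' : (i x).2 = 0 := by simpa [p, Subtype.ext_iff] using hx
        have : i x = 0 := Prod.ext h hx'
        exact Subtype.ext (hi (this.trans (map_zero i).symm)))
  exact Module.finitePresentation_of_ker _ p.surjective_rangeRestrict

variable (hR : IsLeftCoherent R)
include hR

lemma IsLeftCoherent.finitePresentation_pi (n : ℕ) (N : Submodule R (Fin n → R)) (hN : N.FG) :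
    Module.FinitePresentation R N := by
  induction n with
  | zero =>
    have : Subsingleton N := inferInstance
    infer_instance
  | succ n ih =>
    have : Module.Finite R N := Module.Finite.iff_fg.2 hN
    exact finitePresentation_of_injective_prod (M := R) (N := Fin n → R) hR ih
      (i := (Fin.consLinearEquiv R fun _ ↦ R).symm.toLinearMap ∘ₗ N.subtype)
      ((Fin.consLinearEquiv R fun _ ↦ R).symm.injective.comp N.injective_subtype)

/-- Pull `N` back along a finite free presentation of `M`. The preimage is a finitely generated
submodule of a free module, and `N` is its quotient by a finitely generated kernel. -/
lemma IsLeftCoherent.finitePresentation_submodule {M : Type u} [AddCommGroup M] [Module R M]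
    [Module.FinitePresentation R M] (N : Submodule R M) (hN : N.FG) :
    Module.FinitePresentation R N := by
  obtain ⟨n, K, e, hK⟩ := Module.FinitePresentation.exists_fin R M
  let π : (Fin n → R) →ₗ[R] M := e.symm.toLinearMap ∘ₗ K.mkQ
  have hπ : Function.Surjective π := e.symm.surjective.comp K.mkQ_surjective
  have hker : (LinearMap.ker π).FG := by
    have : LinearMap.ker π = K := by simp [π]
    rwa [this]
  let N' := N.comap π
  let q : N' →ₗ[R] N := π.restrict fun x hx ↦ hx
  have hq : Function.Surjective q := by
    rintro ⟨x, hx⟩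
    obtain ⟨y, rfl⟩ := hπ x
    exact ⟨⟨y, hx⟩, rfl⟩
  have hN' : N'.FG := by
    refine Submodule.fg_of_fg_map_of_fg_inf_ker π ?_ ?_
    · rwa [Submodule.map_comap_eq_of_surjective hπ]
    · rwa [inf_eq_right.2 (LinearMap.ker_le_comap π)]
  have := hR.finitePresentation_pi n N' hN'
  refine Module.finitePresentation_of_surjective q hq ?_
  refine Submodule.fg_of_fg_map_injective N'.subtype N'.injective_subtype ?_
  convert hker
  ext x
  simp only [Submodule.mem_map, LinearMap.mem_ker, Submodule.subtype_apply, Subtype.exists,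
    exists_and_right, exists_eq_right]
  refine ⟨fun ⟨h, h'⟩ ↦ congrArg Subtype.val h', fun h ↦ ⟨?_, Subtype.ext h⟩⟩
  exact (LinearMap.ker_le_comap π (p := N)) h

lemma IsLeftCoherent.finitePresentation_ker {M N : Type u} [AddCommGroup M] [Module R M]
    [AddCommGroup N] [Module R N] [Module.FinitePresentation R M] [Module.FinitePresentation R N]
    (f : M →ₗ[R] N) : Module.FinitePresentation R (LinearMap.ker f) := by
  have h₁ := hR.finitePresentation_submodule _ (Submodule.fg_range f)
  have h₂ := Module.FinitePresentation.fg_ker _ f.surjective_rangeRestrict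
  rw [LinearMap.ker_rangeRestrict] at h₂
  exact hR.finitePresentation_submodule _ h₂

/-- Over a coherent ring, the middle term of a five term exact sequence whose other terms are
finitely presented is finitely presented. -/
lemma IsLeftCoherent.finitePresentation_of_exact {M₁ M₂ M₃ M₄ M₅ : Type u}
    [AddCommGroup M₁] [Module R M₁] [AddCommGroup M₂] [Module R M₂] [AddCommGroup M₃] [Module R M₃]
    [AddCommGroup M₄] [Module R M₄] [AddCommGroup M₅] [Module R M₅]
    [Module.Finite R M₁] [Module.FinitePresentation R M₂]
    [Module.FinitePresentation R M₄] [Module.FinitePresentation R M₅]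
    {f : M₁ →ₗ[R] M₂} {g : M₂ →ₗ[R] M₃} {h : M₃ →ₗ[R] M₄} {k : M₄ →ₗ[R] M₅}
    (h₁ : Function.Exact f g) (h₂ : Function.Exact g h) (h₃ : Function.Exact h k) :
    Module.FinitePresentation R M₃ := by
  -- By exactness `M₃` is an extension of the kernel of `k` by the cokernel of `f`.
  have hk := hR.finitePresentation_ker k
  rw [h₃.linearMap_ker_eq] at hk
  have hg : Module.FinitePresentation R (LinearMap.range g) :=
    Module.finitePresentation_of_surjective _ g.surjective_rangeRestrict (by
      rw [LinearMap.ker_rangeRestrict, h₁.linearMap_ker_eq]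
      exact Submodule.fg_range f)
  have : Module.FinitePresentation R (LinearMap.ker h.rangeRestrict) := by
    rwa [LinearMap.ker_rangeRestrict, h₂.linearMap_ker_eq]
  exact Module.finitePresentation_of_ker _ h.surjective_rangeRestrict

end CoherentRings

/-! ### Maps from compact objects to objects of `Coprod P`. -/

section Factorization

open scoped ZeroObject

variable {C : Type u} [Category.{v} C] [Preadditive C] [HasZeroObject C] [HasShift C ℤ]
  [∀ n : ℤ, (shiftFunctor C n).Additive] [Pretriangulated C]
  {P : ObjectProperty C}

lemma exists_biproduct_mem (hP : ∀ T ∈ distTriang C, P T.obj₁ → P T.obj₃ → P T.obj₂) {X Y : C}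
    (hX : P X) (hY : P Y) : P (X ⊞ Y) :=
  hP _ (binaryBiproductTriangle_distinguished X Y) hX hY

/-- The morphisms that factor through an object of a class closed under extensions. -/
def factoringSubgroup (h₀ : P 0) (hP : ∀ T ∈ distTriang C, P T.obj₁ → P T.obj₃ → P T.obj₂)
    (X Y : C) : AddSubgroup (X ⟶ Y) where
  carrier := { f | ∃ (Z : C) (_ : P Z) (a : X ⟶ Z) (b : Z ⟶ Y), f = a ≫ b }
  zero_mem' := ⟨0, h₀, 0, 0, by simp⟩
  add_mem' := by
    rintro _ _ ⟨Z, hZ, a, b, rfl⟩ ⟨Z', hZ', a', b', rfl⟩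
    exact ⟨Z ⊞ Z', exists_biproduct_mem hP hZ hZ', biprod.lift a a', biprod.desc b b', by simp⟩
  neg_mem' := by
    rintro _ ⟨Z, hZ, a, b, rfl⟩
    exact ⟨Z, hZ, -a, b, by simp⟩

/-- If `P` is a class of compact objects that is closed under extensions, then the morphisms from
compact objects to the objects of `Coprod P` factor through objects of `P`. -/
lemma exists_factorization_of_compact (h₀ : P 0)
    (hP : ∀ T ∈ distTriang C, P T.obj₁ → P T.obj₃ → P T.obj₂)
    (hc : P ≤ compactObjects.{w} C) {E : C} (hE : Coprod.{w} P E) {H : C}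
    (hH : compactObjects.{w} C H) (f : H ⟶ E) :
    f ∈ factoringSubgroup h₀ hP H E := by
  induction hE generalizing H with
  | of X hX => exact ⟨X, hX, f, 𝟙 X, by simp⟩
  | coproduct F c hc' _ ih =>
    obtain hf := (compactObjects_iff.1 hH) _ F c hc' f
    refine sigmaHom_range_le (c := c) _ (fun j g ↦ ?_) hf
    obtain ⟨Z, hZ, a, b, rfl⟩ := ih j hH g
    exact ⟨Z, hZ, a, b ≫ c.inj j, by simp⟩
  | ext T hT _ _ ih₁ ih₃ =>
    -- Factor `f ≫ T.mor₂` through `Z` in `P`. The obstruction `b ≫ T.mor₃` to lifting `b` vanishes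
    -- on `H`, so it factors through the cone `W` of `a`. As `W` is compact, induction factors it
    -- further through `Z'⟦1⟧` with `Z'` in `P`. The resulting extension `E'` of `Z` by `Z'` maps to
    -- `T.obj₂` and receives a lift of `a`. The difference to `f` then comes from `T.obj₁`, where
    -- induction applies again.
    obtain ⟨Z, hZ, a, b, hab⟩ := ih₃ hH (f ≫ T.mor₂)
    obtain ⟨W, q, δ, hW⟩ := distinguished_cocone_triangle a
    have h23 : T.mor₂ ≫ T.mor₃ = 0 := comp_distTriang_mor_zero₂₃ _ hT
    obtain ⟨w, hw⟩ := desc_of_distTriang₂ hW (b ≫ T.mor₃) (by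
      rw [← Category.assoc, ← hab, Category.assoc, h23, comp_zero])
    have hWc : compactObjects.{w} C W :=
      compactObjects_ext₂ _ (rot_of_distTriang _ hW) (hc _ hZ) (compactObjects_shift hH 1)
    let e : W⟦(-1 : ℤ)⟧⟦(1 : ℤ)⟧ ≅ W := (shiftFunctorCompIsoId C (-1) 1 (by simp)).app W
    obtain ⟨w', hw'⟩ := (shiftFunctor C (1 : ℤ)).map_surjective (e.hom ≫ w)
    obtain ⟨Z', hZ', c, b', hcb⟩ := ih₁ (compactObjects_shift hWc (-1)) w'
    have hq : a ≫ q = 0 := comp_distTriang_mor_zero₁₂ _ hW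
    have hu : (q ≫ e.inv ≫ c⟦(1 : ℤ)⟧') ≫ b'⟦(1 : ℤ)⟧' = b ≫ T.mor₃ := by
      rw [Category.assoc, Category.assoc, ← Functor.map_comp, ← hcb, hw', e.inv_hom_id_assoc, hw]
    obtain ⟨E', i, p, hE'⟩ := distinguished_cocone_triangle₂ (q ≫ e.inv ≫ c⟦(1 : ℤ)⟧')
    obtain ⟨m, hm₂⟩ : ∃ m : E' ⟶ T.obj₂, p ≫ b = m ≫ T.mor₂ :=
      (complete_distinguished_triangle_morphism₂ _ _ hE' hT b' b hu).imp fun _ h ↦ h.2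
    obtain ⟨l, hl⟩ := lift_of_distTriang₃ hE' a (by
      rw [← Category.assoc, hq, zero_comp])
    obtain ⟨k, hk⟩ := Triangle.coyoneda_exact₂ _ hT (f - l ≫ m) (by
      rw [Preadditive.sub_comp, Category.assoc, ← hm₂, ← Category.assoc, ← hl, hab, sub_self])
    rw [← sub_add_cancel f (l ≫ m), hk]
    obtain ⟨V, hV, x, y, rfl⟩ := ih₁ hH k
    exact add_mem ⟨V, hV, x, y ≫ T.mor₁, by simp⟩ ⟨E', hP _ hE' hZ' hZ, l, m, rfl⟩

/-- If the fibres of two composable morphisms belong to a class closed under extensions, then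
so does the fibre of the composition. -/
lemma exists_fibre_comp [IsTriangulated C]
    (hP : ∀ T ∈ distTriang C, P T.obj₁ → P T.obj₃ → P T.obj₂) {X₁ X₂ X₃ Z₁ Z₂ : C}
    {f₁ : X₁ ⟶ X₂} {f₂ : X₂ ⟶ X₃} {i₁ : Z₁ ⟶ X₁} {j₁ : X₂ ⟶ Z₁⟦(1 : ℤ)⟧} {i₂ : Z₂ ⟶ X₂}
    {j₂ : X₃ ⟶ Z₂⟦(1 : ℤ)⟧} (h₁ : Triangle.mk i₁ f₁ j₁ ∈ distTriang C)
    (h₂ : Triangle.mk i₂ f₂ j₂ ∈ distTriang C) (hZ₁ : P Z₁) (hZ₂ : P Z₂) :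
    ∃ (Z : C) (i : Z ⟶ X₁) (j : X₃ ⟶ Z⟦(1 : ℤ)⟧),
      Triangle.mk i (f₁ ≫ f₂) j ∈ distTriang C ∧ P Z := by
  obtain ⟨Z, i, j, hT⟩ := distinguished_cocone_triangle₁ (f₁ ≫ f₂)
  let o := someOctahedron' rfl h₁ h₂ hT
  exact ⟨Z, i, j, hT, hP _ o.mem hZ₁ hZ₂⟩

/-- If every object bounded above can be approximated by objects of `Coprod P`, then the compact
objects that are bounded above are retracts of objects of `P`. -/
lemma exists_retract_of_compact [IsTriangulated C] [HasCoproducts.{w} C] {t : TStructure C} {G : C}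
    (hG : IsCompactGenerator.{w} G) {a : ℤ} (ha : ∀ Y : C, t.le a Y → ∀ f : G ⟶ Y, f = 0)
    (h₀ : P 0) (hP : ∀ T ∈ distTriang C, P T.obj₁ → P T.obj₃ → P T.obj₂)
    (hc : P ≤ compactObjects.{w} C)
    (happ : ∀ (n : ℤ) (X : C), t.le n X → Nonempty (Approximation t (Coprod.{w} P) X (n - 1)))
    {H : C} (hH : compactObjects.{w} C H) {n : ℤ} (hn : t.le n H) :
    ∃ X, P X ∧ Nonempty (Retract H X) := by
  -- Iterated error terms give a sequence `H = D 0 ⟶ D 1 ⟶ ⋯` moving to `-∞`, and the fibres of the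
  -- maps `H ⟶ D k` lie in `Coprod P`. Compactness of `H` makes one of these maps zero, so `H` is a
  -- retract of an object of `Coprod P`. The inclusion then factors through `P`.
  let A (k : ℕ) (X : {X : C // t.le (n - k) X}) :
      Approximation t (Coprod.{w} P) X.1 (n - k - 1) := (happ _ _ X.2).some
  let D (k : ℕ) : {X : C // t.le (n - k) X} :=
    Nat.rec (motive := fun k ↦ {X : C // t.le (n - k) X}) ⟨H, by simpa using hn⟩
      (fun k X ↦ ⟨(A k X).D, t.le_monotone (by push_cast; lia) _ (A k X).le⟩) k
  let d (k : ℕ) : (D k).1 ⟶ (D (k + 1)).1 := (A k (D k)).g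
  have hd (k : ℕ) : ∃ (Z : C) (i : Z ⟶ H) (j : (D k).1 ⟶ Z⟦(1 : ℤ)⟧),
      Triangle.mk i ((Functor.ofSequence d).map (homOfLE k.zero_le)) j ∈ distTriang C ∧
        Coprod.{w} P Z := by
    induction k with
    | zero =>
      refine ⟨0, 0, 0, ?_, .of _ h₀⟩
      have h : (Functor.ofSequence d).map (homOfLE (Nat.zero_le 0)) = 𝟙 H :=
        (Functor.ofSequence d).map_id 0
      rw [h]
      exact contractible_distinguished₁ H
    | succ k ih =>
      obtain ⟨Z, i, j, hT, hZ⟩ := ih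
      obtain ⟨Z', i', j', hT', hZ'⟩ := exists_fibre_comp (P := Coprod.{w} P)
        (fun T hT h₁ h₃ ↦ .ext T hT h₁ h₃) hT (A k (D k)).dist hZ (A k (D k)).mem
      refine ⟨Z', i', j', ?_, hZ'⟩
      have h := (Functor.ofSequence d).map_comp (homOfLE k.zero_le) (homOfLE k.le_succ)
      rw [Functor.ofSequence_map_homOfLE_succ] at h
      have h' : (Functor.ofSequence d).map (homOfLE (k + 1).zero_le) =
        (Functor.ofSequence d).map (homOfLE k.zero_le) ≫ (A k (D k)).g := h
      rw [h']
      exact hT'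
  obtain ⟨k, hk⟩ := exists_map_eq_zero (E := Functor.ofSequence d) hG hH (fun i ↦
    ⟨(n + i - a).toNat, fun k hk f ↦ hom_shift_eq_zero t ha (D k).2 (by lia) f⟩) (𝟙 H)
  obtain ⟨Z, i, j, hT, hZ⟩ := hd k
  obtain ⟨r⟩ := retract_of_distTriang_of_eq_zero hT ((Category.id_comp _).symm.trans hk)
  obtain ⟨X, hX, x, y, hxy⟩ := exists_factorization_of_compact h₀ hP hc hZ hH r.i
  exact ⟨X, hX, ⟨⟨x, y ≫ r.r, by rw [← Category.assoc, ← hxy, r.retract]⟩⟩⟩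

end Factorization

/-! ### Objects with finitely presented cohomology. -/

section FinitelyPresentedCohomology

open DerivedCategory

open scoped ZeroObject

variable (R : Type u) [Ring R] [HasDerivedCategory.{w} (ModuleCat.{u} R)]

/-- The objects all of whose cohomology modules are finitely presented. -/
def fpCohomology : ObjectProperty (DerivedCategory (ModuleCat.{u} R)) := fun X ↦
  ∀ n : ℤ, Module.FinitePresentation R ((homologyFunctor (ModuleCat.{u} R) n).obj X)

variable {R}

omit [HasDerivedCategory.{w} (ModuleCat.{u} R)] in
lemma finitePresentation_of_isZero {M : ModuleCat.{u} R} (hM : IsZero M) :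
    Module.FinitePresentation R M := by
  have := ModuleCat.subsingleton_of_isZero hM
  infer_instance

omit [HasDerivedCategory.{w} (ModuleCat.{u} R)] in
lemma finitePresentation_of_iso {M N : ModuleCat.{u} R} (e : M ≅ N)
    (h : Module.FinitePresentation R M) : Module.FinitePresentation R N :=
  .of_equiv e.toLinearEquiv

/-- The hypotheses are degreewise because the error term of an approximation is controlled only near
degree `n`. -/
lemma finitePresentation_homology₂ (hR : IsLeftCoherent R)
    {T : Triangle (DerivedCategory (ModuleCat.{u} R))} (hT : T ∈ distTriang _) {n : ℤ}
    (h₁ : Module.FinitePresentation R ((homologyFunctor (ModuleCat.{u} R) (n - 1)).obj T.obj₃))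
    (h₂ : Module.FinitePresentation R ((homologyFunctor (ModuleCat.{u} R) n).obj T.obj₁))
    (h₃ : Module.FinitePresentation R ((homologyFunctor (ModuleCat.{u} R) n).obj T.obj₃))
    (h₄ : Module.FinitePresentation R ((homologyFunctor (ModuleCat.{u} R) (n + 1)).obj T.obj₁)) :
    Module.FinitePresentation R ((homologyFunctor (ModuleCat.{u} R) n).obj T.obj₂) := by
  exact hR.finitePresentation_of_exact
    ((ShortComplex.ShortExact.moduleCat_exact_iff_function_exact _).1
      (HomologySequence.exact₁ T hT (n - 1) n (by lia)))
    ((ShortComplex.ShortExact.moduleCat_exact_iff_function_exact _).1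
      (HomologySequence.exact₂ T hT n))
    ((ShortComplex.ShortExact.moduleCat_exact_iff_function_exact _).1
      (HomologySequence.exact₃ T hT n (n + 1) rfl))

lemma fpCohomology_of_iso {X Y : DerivedCategory (ModuleCat.{u} R)} (e : X ≅ Y)
    (hX : fpCohomology R X) : fpCohomology R Y :=
  fun n ↦ finitePresentation_of_iso ((homologyFunctor _ n).mapIso e) (hX n)

instance : (fpCohomology R).IsClosedUnderIsomorphisms := ⟨fun e h ↦ fpCohomology_of_iso e h⟩

instance : (derivedBoundedMod R).IsClosedUnderIsomorphisms :=
  inferInstanceAs (TStructure.t.bounded ⊓ fpCohomology R).IsClosedUnderIsomorphisms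

lemma fpCohomology_of_retract {X Y : DerivedCategory (ModuleCat.{u} R)} (r : Retract X Y)
    (hY : fpCohomology R Y) : fpCohomology R X := fun n ↦ by
  have := hY n
  let r' := r.map (homologyFunctor (ModuleCat.{u} R) n)
  have h (x) : r'.r.hom (r'.i.hom x) = x :=
    congrArg (fun φ ↦ φ.hom x) r'.retract
  refine Module.finitePresentation_of_surjective r'.r.hom (fun x ↦ ⟨_, h x⟩) ?_
  -- The kernel of the retraction is the image of the complementary idempotent, hence finitely
  -- generated.
  have : LinearMap.ker r'.r.hom = LinearMap.range (LinearMap.id - r'.i.hom ∘ₗ r'.r.hom) := by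
    ext y
    refine ⟨fun hy ↦ ⟨y, ?_⟩, ?_⟩
    · have : r'.r.hom y = 0 := hy
      simp [this]
    · rintro ⟨z, rfl⟩
      simp [h]
  rw [this]
  exact Submodule.fg_range _

lemma isTriangulated_fpCohomology (hR : IsLeftCoherent R) : (fpCohomology R).IsTriangulated where
  exists_zero := ⟨0, isZero_zero _, fun n ↦
    finitePresentation_of_isZero ((homologyFunctor _ n).map_isZero (isZero_zero _))⟩
  isStableUnderShiftBy a := ⟨fun X hX n ↦
    finitePresentation_of_iso (homologyShiftIso X a n (a + n) rfl).symm (hX _)⟩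
  ext₂' _ hT h₁ h₃ := ObjectProperty.le_isoClosure _ _ fun _ ↦
    finitePresentation_homology₂ hR hT (h₃ _) (h₁ _) (h₃ _) (h₁ _)

lemma isTriangulated_derivedBoundedMod (hR : IsLeftCoherent R) :
    (derivedBoundedMod R).IsTriangulated := by
  have := isTriangulated_fpCohomology hR
  exact inferInstanceAs (TStructure.t.bounded ⊓ fpCohomology R).IsTriangulated

variable (R) in
/-- The free module of rank `k`, in degree zero. -/
noncomputable abbrev freeObj (k : ℕ) : DerivedCategory (ModuleCat.{u} R) :=
  (singleFunctor (ModuleCat.{u} R) 0).obj (ModuleCat.of R (Fin k → R))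

variable (R) in
lemma le_zero_freeObj (k : ℕ) : TStructure.t.le 0 (freeObj R k) :=
  (inferInstance : ((singleFunctor (ModuleCat.{u} R) 0).obj (ModuleCat.of R (Fin k → R))).IsLE 0).le

variable (R) in
lemma ge_zero_freeObj (k : ℕ) : TStructure.t.ge 0 (freeObj R k) :=
  (inferInstance : ((singleFunctor (ModuleCat.{u} R) 0).obj (ModuleCat.of R (Fin k → R))).IsGE 0).ge

/-- The cohomology in degree zero of a module, as an object of the derived category. -/
noncomputable def homologySingleIso (M : ModuleCat.{u} R) :
    (homologyFunctor (ModuleCat.{u} R) 0).obj ((singleFunctor (ModuleCat.{u} R) 0).obj M) ≅ M :=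
  homologyQIso ((HomologicalComplex.single _ (.up ℤ) 0).obj M) 0 ≪≫
    HomologicalComplex.singleObjHomologySelfIso (.up ℤ) 0 M

lemma fpCohomology_single {M : ModuleCat.{u} R} (hM : Module.FinitePresentation R M) :
    fpCohomology R ((singleFunctor (ModuleCat.{u} R) 0).obj M) := fun n ↦ by
  obtain h | rfl | h := lt_trichotomy n 0
  · exact finitePresentation_of_isZero (isZero_of_isGE _ 0 n h)
  · exact finitePresentation_of_iso (homologySingleIso M).symm hM
  · exact finitePresentation_of_isZero (isZero_of_isLE _ 0 n h)

variable (R) in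
lemma derivedBoundedMod_freeObj (k : ℕ) : derivedBoundedMod R (freeObj R k) :=
  ⟨⟨⟨0, ⟨ge_zero_freeObj R k⟩⟩, ⟨0, ⟨le_zero_freeObj R k⟩⟩⟩,
    fpCohomology_single (M := ModuleCat.of R (Fin k → R))
      (inferInstanceAs (Module.FinitePresentation R (Fin k → R)))⟩

variable (R) in
lemma compact_freeObj (k : ℕ) : compactObjects.{u} _ (freeObj R k) := by
  let X : Fin k → ModuleCat.{u} R := fun _ ↦ ModuleCat.of R R
  let e : ModuleCat.of R (Fin k → R) ≅ ⨁ X := (ModuleCat.biproductIsoPi X).symm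
  refine compactObjects_of_iso ((singleFunctor _ 0).mapIso e ≪≫ (singleFunctor _ 0).mapBiproduct X)
    (compactObjects_biproduct _ fun _ ↦ compact_ringObj R)

lemma hom_freeObj_eq_zero {k : ℕ} {X : DerivedCategory (ModuleCat.{u} R)}
    (hX : TStructure.t.le (-1) X) (f : freeObj R k ⟶ X) : f = 0 :=
  single_hom_eq_zero (P := ModuleCat.of R (Fin k → R)) (by simp) hX f

/-- If the top cohomology is finitely generated, then it is covered by a free module of finite
rank. -/
lemma exists_freeObj_approximation {F : DerivedCategory (ModuleCat.{u} R)}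
    (hF : TStructure.t.le 0 F)
    (hF' : Module.Finite R ((homologyFunctor (ModuleCat.{u} R) 0).obj F)) :
    ∃ (k : ℕ) (D : DerivedCategory (ModuleCat.{u} R)) (f : freeObj R k ⟶ F) (g : F ⟶ D)
      (h : D ⟶ (freeObj R k)⟦(1 : ℤ)⟧),
      Triangle.mk f g h ∈ distTriang _ ∧ TStructure.t.le (-1) D := by
  obtain ⟨k, φ, hφ⟩ := Module.Finite.exists_fin' R ((homologyFunctor (ModuleCat.{u} R) 0).obj F)
  obtain ⟨θ, f, hf⟩ := exists_single_hom (P := ModuleCat.of R (Fin k → R)) (ModuleCat.ofHom φ)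
  obtain ⟨D, g, h, hT⟩ := distinguished_cocone_triangle f
  refine ⟨k, D, f, g, h, hT, le_of_epi_homology hT (le_zero_freeObj R k) hF ?_⟩
  have : Epi (ModuleCat.ofHom φ) := (ModuleCat.epi_iff_surjective _).2 hφ
  rw [← hf] at this
  exact epi_of_epi θ _

end FinitelyPresentedCohomology

/-! ### Pseudo-compact objects and coherence for `D(Mod R)`. -/

section RingCoherent

open DerivedCategory

open scoped ZeroObject

variable {R : Type u} [Ring R] [HasDerivedCategory.{w} (ModuleCat.{u} R)]

lemma exists_freeObj_triangle {F : DerivedCategory (ModuleCat.{u} R)} {n : ℤ}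
    (hF : TStructure.t.le n F)
    (hF' : Module.Finite R ((homologyFunctor (ModuleCat.{u} R) n).obj F)) :
    ∃ (k : ℕ) (D : DerivedCategory (ModuleCat.{u} R)) (f : (freeObj R k)⟦-n⟧ ⟶ F) (g : F ⟶ D)
      (h : D ⟶ ((freeObj R k)⟦-n⟧)⟦(1 : ℤ)⟧),
      Triangle.mk f g h ∈ distTriang _ ∧ TStructure.t.le (n - 1) D := by
  obtain ⟨k, D, f, g, h, hT, hD⟩ := exists_freeObj_approximation
    (TStructure.t.le_shift n n 0 (by simp) _ hF)
    (Module.Finite.equiv (homologyShiftIso F n 0 n (by simp)).symm.toLinearEquiv)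
  obtain ⟨f', g', h', hT'⟩ := exists_distTriang_of_shift hT
  exact ⟨k, _, f', g', h', hT', TStructure.t.le_shift _ _ _ (by ring) _ hD⟩

lemma compact_and_mod_ext (hR : IsLeftCoherent R) :
    ∀ T ∈ distTriang (DerivedCategory (ModuleCat.{u} R)),
      (compactObjects.{u} _ ⊓ derivedBoundedMod R) T.obj₁ →
      (compactObjects.{u} _ ⊓ derivedBoundedMod R) T.obj₃ →
      (compactObjects.{u} _ ⊓ derivedBoundedMod R) T.obj₂ := by
  have := isTriangulated_derivedBoundedMod hR
  exact fun T hT h₁ h₃ ↦ ⟨compactObjects_ext₂ T hT h₁.1 h₃.1,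
    ObjectProperty.ext_of_isTriangulatedClosed₂ _ T hT h₁.2 h₃.2⟩

lemma compact_and_mod_of_isZero (hR : IsLeftCoherent R) :
    (compactObjects.{u} _ ⊓ derivedBoundedMod R) (0 : DerivedCategory (ModuleCat.{u} R)) := by
  have := isTriangulated_derivedBoundedMod hR
  exact ⟨compactObjects_of_isZero (isZero_zero _), ObjectProperty.prop_zero _⟩

/-- Over a coherent ring, a compact object has bounded cohomology consisting of finitely presented
modules. -/
theorem derivedBoundedMod_of_compact (hR : IsLeftCoherent R)
    {H : DerivedCategory (ModuleCat.{u} R)} (hH : compactObjects.{u} _ H) :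
    derivedBoundedMod R H := by
  have := isTriangulated_derivedBoundedMod hR
  obtain ⟨n, hn⟩ := exists_le_of_compact (isPreferred_t R) hH
  have hring (i : ℤ) : (compactObjects.{u} _ ⊓ derivedBoundedMod R) ((ringObj R)⟦i⟧) :=
    ⟨compactObjects_shift (compact_ringObj R) i, (derivedBoundedMod R).le_shift i (ringObj R)
      ⟨⟨⟨0, inferInstance⟩, ⟨0, inferInstance⟩⟩, fpCohomology_single (M := ModuleCat.of R R)
        (inferInstanceAs (Module.FinitePresentation R R))⟩⟩
  -- The class `P` of compact objects in `D^b(mod R)` contains the shifts of the ring, and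
  -- coproducts of these suffice for approximation.
  obtain ⟨X, hX, ⟨r⟩⟩ := exists_retract_of_compact (P := compactObjects.{u} _ ⊓ derivedBoundedMod R)
    (isCompactGenerator_ringObj R)
    (fun Y hY f ↦ hom_ringObj_eq_zero hY f) (compact_and_mod_of_isZero hR) (compact_and_mod_ext hR)
    (fun X hX ↦ hX.1) (fun n X hX ↦ by
      obtain ⟨J, D, f, g, h, hT, hD⟩ := exists_ringObj_approximation
        (TStructure.t.le_shift n n 0 (by simp) _ hX)
      obtain ⟨f', g', h', hT'⟩ := exists_distTriang_of_shift hT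
      exact ⟨⟨_, _, f', g', h', hT', Coprod.shift (P := fun X ↦ X = ringObj R)
        (by rintro _ rfl; exact .of _ (hring _))
        (.coproduct _ _ (coproductIsCoproduct _) fun _ ↦ .of _ rfl),
        TStructure.t.le_shift _ _ _ (by ring) _ hD⟩⟩) hH hn
  obtain ⟨⟨⟨a, ha⟩, ⟨b, hb⟩⟩, hfp⟩ := hX.2
  exact ⟨⟨⟨a, ⟨ge_of_retract _ r ha.ge⟩⟩, ⟨b, ⟨le_of_retract _ r hb.le⟩⟩⟩,
    fpCohomology_of_retract r hfp⟩

/-- Each step covers the top cohomology of the error term by a finite free module. Coherence keeps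
the cohomology of the new error term finitely presented, so the process continues. -/
lemma exists_approximation_of_fpCohomology (hR : IsLeftCoherent R)
    {F : DerivedCategory (ModuleCat.{u} R)} {n : ℤ} (hn : TStructure.t.le n F)
    (hF : fpCohomology R F) (k : ℕ) :
    Nonempty (Approximation TStructure.t (compactObjects.{u} _ ⊓ derivedBoundedMod R) F
      (n - k)) := by
  have := isTriangulated_derivedBoundedMod hR
  have := isTriangulated_fpCohomology hR
  induction k with
  | zero =>
    exact ⟨⟨0, F, 0, 𝟙 F, 0, contractible_distinguished₁ F, compact_and_mod_of_isZero hR,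
      by simpa using hn⟩⟩
  | succ k ih =>
    obtain ⟨a⟩ := ih
    have hD : fpCohomology R a.D := ObjectProperty.ext_of_isTriangulatedClosed₃ _ _ a.dist
      a.mem.2.2 hF
    have := hD (n - k)
    obtain ⟨m, D, f, g, h, hT, hD⟩ := exists_freeObj_triangle a.le inferInstance
    obtain ⟨c, -⟩ := a.exists_succ (compact_and_mod_ext hR)
      ⟨_, D, f, g, h, hT, ⟨compactObjects_shift (compact_freeObj R m) _,
        ObjectProperty.le_shift _ _ _ (derivedBoundedMod_freeObj R m)⟩, hD⟩
    rw [sub_sub] at c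
    exact ⟨by exact_mod_cast c⟩

lemma pseudoCompact_of_fpCohomology (hR : IsLeftCoherent R)
    {F : DerivedCategory (ModuleCat.{u} R)} {n : ℤ} (hn : TStructure.t.le n F)
    (hF : fpCohomology R F) : pseudoCompactObjects.{u} _ F := by
  refine ⟨_, isPreferred_t R, fun m _ ↦ ?_⟩
  obtain ⟨a⟩ := exists_approximation_of_fpCohomology hR hn hF (n + m).toNat
  exact ⟨a.E, a.D, a.f, a.g, a.h, a.dist, a.mem.1, TStructure.t.le_monotone (by lia) _ a.le⟩

lemma le_and_fpCohomology_of_pseudoCompact (hR : IsLeftCoherent R)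
    {F : DerivedCategory (ModuleCat.{u} R)} (hF : pseudoCompactObjects.{u} _ F) :
    (∃ n : ℤ, TStructure.t.le n F) ∧ fpCohomology R F := by
  constructor
  · obtain ⟨a⟩ := pseudoCompact_approximation (isPreferred_t R) hF 0
    obtain ⟨n, hn⟩ := exists_le_of_compact (isPreferred_t R) a.mem
    have h := ObjectProperty.ext_of_isTriangulatedClosed₂ TStructure.t.minus _ a.dist
      ⟨n, ⟨hn⟩⟩ ⟨0, ⟨a.le⟩⟩
    obtain ⟨m, hm⟩ := h
    exact ⟨m, hm.le⟩
  · intro n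
    -- With error term in degrees `≤ n - 2`, its cohomology in degrees `n - 1` and `n` vanishes, and
    -- `H^n` of `F` is that of a compact object.
    obtain ⟨a⟩ := pseudoCompact_approximation (isPreferred_t R) hF (n - 2)
    have hE := (derivedBoundedMod_of_compact hR a.mem).2
    have hD : a.D.IsLE (n - 2) := ⟨a.le⟩
    exact finitePresentation_homology₂ hR a.dist
      (finitePresentation_of_isZero (isZero_of_isLE a.D (n - 2) (n - 1) (by lia))) (hE _)
      (finitePresentation_of_isZero (isZero_of_isLE a.D (n - 2) n (by lia))) (hE _)

/-- The truncation triangle of an object with finitely presented cohomology. -/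
lemma fpCohomology_truncation (hR : IsLeftCoherent R) {X Y Z : DerivedCategory (ModuleCat.{u} R)}
    {f : X ⟶ Y} {g : Y ⟶ Z} {h : Z ⟶ X⟦(1 : ℤ)⟧} (hT : Triangle.mk f g h ∈ distTriang _) {n : ℤ}
    (hX : TStructure.t.le (n - 1) X) (hZ : TStructure.t.ge n Z) (hY : fpCohomology R Y) :
    fpCohomology R X ∧ fpCohomology R Z := by
  have := isTriangulated_fpCohomology hR
  have hX' : X.IsLE (n - 1) := ⟨hX⟩
  have hZ' : Z.IsGE n := ⟨hZ⟩
  have hXfp : fpCohomology R X := by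
    intro i
    by_cases hi : n ≤ i
    · exact finitePresentation_of_isZero (isZero_of_isLE X (n - 1) i (by lia))
    · have e : IsIso ((homologyFunctor (ModuleCat.{u} R) i).map f) := by
        have h₁ := (HomologySequence.mono_homologyMap_mor₁_iff _ hT (i - 1) i (by lia)).2
          ((isZero_of_isGE Z n (i - 1) (by lia)).eq_of_src _ _)
        have h₂ := (HomologySequence.epi_homologyMap_mor₁_iff _ hT i).2
          ((isZero_of_isGE Z n i (by lia)).eq_of_tgt _ _)
        exact @isIso_of_mono_of_epi _ _ _ _ _ _ h₁ h₂
      exact finitePresentation_of_iso (asIso ((homologyFunctor (ModuleCat.{u} R) i).map f)).symm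
        (hY i)
  exact ⟨hXfp, ObjectProperty.ext_of_isTriangulatedClosed₃ _ _ hT hXfp hY⟩

theorem isCoherent_derivedCategory (hR : IsLeftCoherent R) :
    IsCoherent.{u} (DerivedCategory (ModuleCat.{u} R)) := by
  intro t ht
  obtain ⟨c, hc⟩ := exists_le_of_isPreferred (isPreferred_t R) ht
  obtain ⟨c', hc'⟩ := exists_le_of_isPreferred ht (isPreferred_t R)
  -- Truncating at `c'` in the standard t-structure puts the upper part in `t.ge 0` and the lower
  -- part in `t.le (c' - 1 + c)`; the summand `1` makes the bound positive.
  refine ⟨c + c' + 1, by lia, fun Y hY ↦ ?_⟩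
  obtain ⟨⟨m, hm⟩, hfp⟩ := le_and_fpCohomology_of_pseudoCompact hR hY
  let s : TStructure (DerivedCategory (ModuleCat.{u} R)) := TStructure.t
  have hT := s.triangleLTGE_distinguished c' Y
  have hX : s.le (c' - 1) ((s.truncLT c').obj Y) :=
    (inferInstance : s.IsLE ((s.truncLT c').obj Y) (c' - 1)).le
  have hZ : s.ge c' ((s.truncGE c').obj Y) :=
    (inferInstance : s.IsGE ((s.truncGE c').obj Y) c').ge
  obtain ⟨hX', hZ'⟩ := fpCohomology_truncation hR hT hX hZ hfp
  obtain ⟨k, hk⟩ : s.minus ((s.truncGE c').obj Y) :=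
    ObjectProperty.ext_of_isTriangulatedClosed₃ s.minus _ hT ⟨_, ⟨hX⟩⟩ ⟨m, ⟨hm⟩⟩
  refine ⟨_, _, _, _, _, hT, ⟨pseudoCompact_of_fpCohomology hR hX hX',
    t.le_monotone (by push_cast; lia) _ (hc _ _ hX)⟩,
    ⟨pseudoCompact_of_fpCohomology hR hk.le hZ', s, isPreferred_t R, ⟨c', ⟨hZ⟩⟩, k, hk⟩, ?_⟩
  have := ge_of_forall_le hc' hZ
  rwa [sub_self] at this

theorem compact_le_boundedPseudoCompact (hR : IsLeftCoherent R) :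
    compactObjects.{u} (DerivedCategory (ModuleCat.{u} R)) ≤
      boundedPseudoCompactObjects.{u} (DerivedCategory (ModuleCat.{u} R)) := by
  intro H hH
  obtain ⟨hb, hfp⟩ := derivedBoundedMod_of_compact hR hH
  obtain ⟨n, hn⟩ := hb.2
  exact ⟨pseudoCompact_of_fpCohomology hR hn.le hfp, _, isPreferred_t R, hb⟩

end RingCoherent

/-! ### Perfect objects and their characterization by vanishing of morphisms. -/

section PerfectObjects

open DerivedCategory

variable {R : Type u} [Ring R]

/-- The finitely generated projective modules. -/
def finiteProjective (R : Type u) [Ring R] : ObjectProperty (ModuleCat.{u} R) :=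
  fun M ↦ Module.Finite R M ∧ Module.Projective R M

lemma finiteProjective_of_iso {M N : ModuleCat.{u} R} (e : M ≅ N) (h : finiteProjective R M) :
    finiteProjective R N :=
  have := h.1
  have := h.2
  ⟨Module.Finite.equiv e.toLinearEquiv, Module.Projective.of_equiv e.toLinearEquiv⟩

lemma finiteProjective_of_isZero {M : ModuleCat.{u} R} (hM : IsZero M) : finiteProjective R M := by
  have : Subsingleton M := ModuleCat.subsingleton_of_isZero hM
  have := Module.Free.of_subsingleton R M
  exact ⟨Module.Finite.of_finite, Module.Projective.of_free⟩

lemma finiteProjective_biprod {M N : ModuleCat.{u} R} (hM : finiteProjective R M)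
    (hN : finiteProjective R N) : finiteProjective R (M ⊞ N) := by
  have := hM.1
  have := hM.2
  have := hN.1
  have := hN.2
  exact finiteProjective_of_iso (ModuleCat.biprodIsoProd M N).symm
    ⟨inferInstanceAs (Module.Finite R (M × N)), inferInstanceAs (Module.Projective R (M × N))⟩

lemma isKProjective_of_finiteProjective (K : CochainComplex (ModuleCat.{u} R) ℤ) (b : ℤ)
    [K.IsStrictlyLE b] (hK : ∀ i, finiteProjective R (K.X i)) : K.IsKProjective := by
  have (i : ℤ) : Projective (K.X i) := by
    have := (hK i).2
    infer_instance
  exact CochainComplex.isKProjective_of_projective K b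

variable [HasDerivedCategory.{w} (ModuleCat.{u} R)]

lemma derivedBoundedProj_of_iso {X Y : DerivedCategory (ModuleCat.{u} R)} (e : X ≅ Y)
    (hX : derivedBoundedProj R X) : derivedBoundedProj R Y := by
  obtain ⟨K, a, b, ha, hb, hK, ⟨e'⟩⟩ := hX
  exact ⟨K, a, b, ha, hb, hK, ⟨e.symm ≪≫ e'⟩⟩

lemma derivedBoundedProj_single {M : ModuleCat.{u} R} (hM : finiteProjective R M) :
    derivedBoundedProj R ((singleFunctor (ModuleCat.{u} R) 0).obj M) := by
  refine ⟨(HomologicalComplex.single _ (.up ℤ) 0).obj M, 0, 0,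
    inferInstanceAs (CochainComplex.IsStrictlyGE ((CochainComplex.singleFunctor _ 0).obj M) 0),
    inferInstanceAs (CochainComplex.IsStrictlyLE ((CochainComplex.singleFunctor _ 0).obj M) 0),
    fun i ↦ ?_, ⟨Iso.refl _⟩⟩
  by_cases hi : i = 0
  · subst hi
    exact finiteProjective_of_iso (HomologicalComplex.singleObjXSelf (.up ℤ) 0 M).symm hM
  · exact finiteProjective_of_isZero (HomologicalComplex.isZero_single_obj_X (.up ℤ) 0 M i hi)

/-- There are no morphisms from a bounded complex of projectives to complexes whose cohomology is
concentrated in sufficiently small degrees. -/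
lemma exists_hom_eq_zero_of_derivedBoundedProj {X : DerivedCategory (ModuleCat.{u} R)}
    (hX : derivedBoundedProj R X) :
    ∃ n : ℤ, ∀ Y, TStructure.t.le n Y → ∀ f : X ⟶ Y, f = 0 := by
  obtain ⟨K, a, b, ha, hb, hK, ⟨e⟩⟩ := hX
  have := isKProjective_of_finiteProjective K b hK
  refine ⟨a - 1, fun Y hY f ↦ ?_⟩
  rw [← cancel_epi e.inv, comp_zero]
  exact hom_eq_zero_of_isStrictlyGE (n := a) (by lia) hY _

/-- The cone of a morphism between bounded complexes of finitely generated projectives is a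
complex of the same kind. -/
lemma derivedBoundedProj_ext₃ {X Y Z : DerivedCategory (ModuleCat.{u} R)} {f : X ⟶ Y} {g : Y ⟶ Z}
    {h : Z ⟶ X⟦(1 : ℤ)⟧} (hT : Triangle.mk f g h ∈ distTriang _) (hX : derivedBoundedProj R X)
    (hY : derivedBoundedProj R Y) : derivedBoundedProj R Z := by
  obtain ⟨K, a, b, ha, hb, hK, ⟨e⟩⟩ := hX
  obtain ⟨L, a', b', ha', hb', hL, ⟨e'⟩⟩ := hY
  have := isKProjective_of_finiteProjective K b hK
  -- K-projectivity represents `f` by a map of complexes, so `Z` is its mapping cone, with terms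
  -- `K.X (n + 1) ⊞ L.X n`.
  obtain ⟨φ, hφ⟩ := exists_Q_map_eq (e.inv ≫ f ≫ e'.hom)
  let i := isoTriangleOfIso₁₂ _ _ hT (mappingCone_triangle_distinguished φ) e e'
    ((Iso.eq_inv_comp e).1 hφ.symm).symm
  have hX (n : ℤ) : (CochainComplex.mappingCone φ).X n ≅ K.X (n + 1) ⊞ L.X n :=
    HomologicalComplex.homotopyCofiber.XIsoBiprod φ n (n + 1) rfl
  refine ⟨CochainComplex.mappingCone φ, min (a - 1) a', max b b', ?_, ?_, fun n ↦
    finiteProjective_of_iso (hX n).symm (finiteProjective_biprod (hK _) (hL _)),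
    ⟨Triangle.π₃.mapIso i⟩⟩
  · rw [CochainComplex.isStrictlyGE_iff]
    intro n hn
    exact IsZero.of_iso ((biprod_isZero_iff _ _).2 ⟨K.isZero_of_isStrictlyGE a _ (by lia),
      L.isZero_of_isStrictlyGE a' _ (by lia)⟩) (hX n)
  · rw [CochainComplex.isStrictlyLE_iff]
    intro n hn
    exact IsZero.of_iso ((biprod_isZero_iff _ _).2 ⟨K.isZero_of_isStrictlyLE b _ (by lia),
      L.isZero_of_isStrictlyLE b' _ (by lia)⟩) (hX n)

omit [HasDerivedCategory.{w} (ModuleCat.{u} R)] in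
lemma finitePresentation_shortComplex_homology (hR : IsLeftCoherent R)
    (S : ShortComplex (ModuleCat.{u} R)) [Module.Finite R S.X₁] [Module.FinitePresentation R S.X₂]
    [Module.FinitePresentation R S.X₃] : Module.FinitePresentation R S.homology := by
  have := hR.finitePresentation_ker S.g.hom
  have key : Module.FinitePresentation R
      (LinearMap.ker S.g.hom ⧸ LinearMap.range S.moduleCatToCycles) := by
    refine Module.finitePresentation_of_surjective
      (LinearMap.range S.moduleCatToCycles).mkQ (Submodule.mkQ_surjective _) ?_
    rw [Submodule.ker_mkQ]
    exact Module.Finite.iff_fg.1 (Module.Finite.range _)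
  exact finitePresentation_of_iso S.moduleCatHomologyIso.symm key

lemma derivedBoundedProj_le_derivedBoundedMod (hR : IsLeftCoherent R) :
    derivedBoundedProj R ≤ derivedBoundedMod R := by
  rintro X ⟨K, a, b, ha, hb, hK, ⟨e⟩⟩
  refine (derivedBoundedMod R).prop_of_iso e.symm ⟨⟨⟨a, inferInstance⟩, ⟨b, inferInstance⟩⟩,
    fun n ↦ finitePresentation_of_iso (homologyQIso K n).symm ?_⟩
  have hfp (i : ℤ) : Module.FinitePresentation R (K.X i) := by
    have := (hK i).1
    have := (hK i).2
    exact Module.finitePresentation_of_projective R _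
  have : Module.Finite R (K.sc n).X₁ := (hK _).1
  have : Module.FinitePresentation R (K.sc n).X₂ := hfp _
  have : Module.FinitePresentation R (K.sc n).X₃ := hfp _
  exact finitePresentation_shortComplex_homology hR (K.sc n)

/-- A retract of a module in degree zero is again such a module, and full faithfulness makes it a
direct summand of `R^k`. -/
lemma derivedBoundedProj_of_retract_freeObj {X : DerivedCategory (ModuleCat.{u} R)} {k : ℕ}
    (r : Retract X (freeObj R k)) : derivedBoundedProj R X := by
  have h₁ : X.IsGE 0 := ⟨ge_of_retract _ r (ge_zero_freeObj R k)⟩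
  have h₂ : X.IsLE 0 := ⟨le_of_retract _ r (le_zero_freeObj R k)⟩
  obtain ⟨M, ⟨e⟩⟩ := exists_iso_singleFunctor_obj_of_isGE_of_isLE X 0
  refine derivedBoundedProj_of_iso e.symm (derivedBoundedProj_single ?_)
  obtain ⟨i, hi⟩ := (singleFunctor (ModuleCat.{u} R) 0).map_surjective (e.inv ≫ r.i)
  obtain ⟨p, hp⟩ := (singleFunctor (ModuleCat.{u} R) 0).map_surjective (r.r ≫ e.hom)
  have hip : i ≫ p = 𝟙 M := by
    apply (singleFunctor (ModuleCat.{u} R) 0).map_injective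
    rw [Functor.map_comp, hi, hp, Category.assoc, r.retract_assoc, e.inv_hom_id,
      CategoryTheory.Functor.map_id]
  have hip' : p.hom ∘ₗ i.hom = LinearMap.id := congrArg (fun φ ↦ φ.hom) hip
  exact ⟨Module.Finite.of_surjective p.hom fun x ↦ ⟨i.hom x, LinearMap.congr_fun hip' x⟩,
    Module.Projective.of_split i.hom p.hom hip'⟩

lemma eq_zero_of_shift_neg_one {D Y : DerivedCategory (ModuleCat.{u} R)}
    (h : ∀ v : D ⟶ Y⟦(1 : ℤ)⟧, v = 0) (u : D⟦(-1 : ℤ)⟧ ⟶ Y) : u = 0 := by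
  let e := (shiftFunctorCompIsoId (DerivedCategory (ModuleCat.{u} R)) (-1 : ℤ) 1 (by simp)).app D
  apply (shiftFunctor _ (1 : ℤ)).map_injective
  rw [← cancel_epi e.inv, Functor.map_zero, comp_zero]
  exact h _

/-- Dimension shifting: `k` bounds the number of syzygies still to be taken. For `k = 0` the map
from `X` to the cone `D` of a free cover vanishes, so `X` is a retract of a shifted free module.
Otherwise `X` is the cone of `D⟦-1⟧ ⟶ (freeObj R l)⟦-m⟧`. The syzygy `D⟦-1⟧` has the same bound `m`
and satisfies the hypothesis with `k` lowered by one. -/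
lemma derivedBoundedProj_of_hom_eq_zero_aux (hR : IsLeftCoherent R) (k : ℕ) (m : ℤ)
    {X : DerivedCategory (ModuleCat.{u} R)} (hX : derivedBoundedMod R X)
    (hm : TStructure.t.le m X)
    (h : ∀ Y, derivedBoundedMod R Y → TStructure.t.le (m - 1 - k) Y → ∀ f : X ⟶ Y, f = 0) :
    derivedBoundedProj R X := by
  have := isTriangulated_derivedBoundedMod hR
  induction k generalizing X with
  | zero =>
    have := hX.2 m
    obtain ⟨k, D, f, g, δ, hT, hD⟩ := exists_freeObj_triangle hm inferInstance
    have hD' : derivedBoundedMod R D := ObjectProperty.ext_of_isTriangulatedClosed₃ _ _ hT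
      ((derivedBoundedMod R).le_shift _ _ (derivedBoundedMod_freeObj R k)) hX
    obtain ⟨r⟩ := retract_of_distTriang_of_eq_zero hT (h D hD' (by simpa using hD) g)
    have e (Y : DerivedCategory (ModuleCat.{u} R)) (i j : ℤ) (hij : i + j = 0) : Y⟦i⟧⟦j⟧ ≅ Y :=
      (shiftFunctorCompIsoId _ i j hij).app Y
    have r' : Retract (X⟦m⟧) (freeObj R k) :=
      (r.map (shiftFunctor _ m)).trans (Retract.ofIso (e (freeObj R k) (-m) m (neg_add_cancel m)))
    exact derivedBoundedProj_of_iso (e X m (-m) (by simp))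
      ((derivedBoundedProj R).le_shift (-m) _ (derivedBoundedProj_of_retract_freeObj r'))
  | succ k ih =>
    have := hX.2 m
    obtain ⟨l, D, f, g, δ, hT, hD⟩ := exists_freeObj_triangle hm inferInstance
    have hF := (derivedBoundedMod R).le_shift (-m) _ (derivedBoundedMod_freeObj R l)
    have hF' : derivedBoundedProj R ((freeObj R l)⟦-m⟧) :=
      (derivedBoundedProj R).le_shift (-m) _ (derivedBoundedProj_single
        (M := ModuleCat.of R (Fin l → R)) ⟨inferInstanceAs (Module.Finite R (Fin l → R)),
          inferInstanceAs (Module.Projective R (Fin l → R))⟩)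
    have hD' : derivedBoundedMod R D := ObjectProperty.ext_of_isTriangulatedClosed₃ _ _ hT hF hX
    have hT' := inv_rot_of_distTriang _ hT
    refine derivedBoundedProj_ext₃ hT' (ih ((derivedBoundedMod R).le_shift (-1) _ hD')
      (TStructure.t.le_shift (m - 1) (-1) m (by ring) _ hD) fun Y hY hY' u ↦ ?_) hF'
    -- Maps `D ⟶ Y⟦1⟧` lie between maps from `X`, which vanish by hypothesis, and maps from the
    -- shifted free module, which vanish because `Y` lives below degree `m`.
    have hFY (v : ((freeObj R l)⟦-m⟧)⟦(1 : ℤ)⟧ ⟶ Y⟦(1 : ℤ)⟧) : v = 0 := by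
      obtain ⟨w, rfl⟩ := (shiftFunctor _ (1 : ℤ)).map_surjective v
      rw [hom_shift_eq_zero TStructure.t (fun Z hZ f ↦ hom_freeObj_eq_zero hZ f) hY' (by lia) w,
        Functor.map_zero]
    have hDY (v : D ⟶ Y⟦(1 : ℤ)⟧) : v = 0 := by
      obtain ⟨w, hw⟩ := desc_of_distTriang₃ hT v (h _ ((derivedBoundedMod R).le_shift 1 _ hY)
        (TStructure.t.le_shift _ 1 _ (by push_cast; ring) _ hY') _)
      rw [hw, hFY w, comp_zero]
    exact eq_zero_of_shift_neg_one hDY u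

/-- A bounded complex with finitely presented cohomology is perfect if it has no nonzero morphisms
to the complexes of the same kind whose cohomology is in sufficiently small degrees. -/
lemma derivedBoundedProj_of_hom_eq_zero (hR : IsLeftCoherent R)
    {X : DerivedCategory (ModuleCat.{u} R)} (hX : derivedBoundedMod R X) {n : ℤ}
    (h : ∀ Y, derivedBoundedMod R Y → TStructure.t.le n Y → ∀ f : X ⟶ Y, f = 0) :
    derivedBoundedProj R X := by
  obtain ⟨m, hm⟩ := hX.1.2
  exact derivedBoundedProj_of_hom_eq_zero_aux hR (m - 1 - n).toNat m hX hm.le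
    fun Y hY hY' ↦ h Y hY (TStructure.t.le_monotone (by lia) _ hY')

end PerfectObjects

/-! ### Restricting triangulated equivalences to subcategories. -/

section Restriction

variable {C : Type*} [Category* C] [Preadditive C] [HasZeroObject C] [HasShift C ℤ]
  [∀ n : ℤ, (shiftFunctor C n).Additive] [Pretriangulated C]
  {D : Type*} [Category* D] [Preadditive D] [HasZeroObject D] [HasShift D ℤ]
  [∀ n : ℤ, (shiftFunctor D n).Additive] [Pretriangulated D]
  {P P' : ObjectProperty C} [P.IsStableUnderShift ℤ] [P'.IsStableUnderShift ℤ]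
  {Q Q' : ObjectProperty D} [Q.IsStableUnderShift ℤ] [Q'.IsStableUnderShift ℤ]

/-- A triangulated equivalence between `P` and `Q` restricts to one between the subcategories
`P' ≤ P` and `Q' ≤ Q` if it and its inverse respect them. -/
lemma triangulatedEquivalent_of_le (hP : P' ≤ P) (hQ : Q' ≤ Q) [Q'.IsClosedUnderIsomorphisms]
    (e : P.FullSubcategory ≌ Q.FullSubcategory) [e.functor.CommShift ℤ]
    (he : ∀ T : Triangle P.FullSubcategory, P.ι.mapTriangle.obj T ∈ distTriang C →
      Q.ι.mapTriangle.obj (e.functor.mapTriangle.obj T) ∈ distTriang D)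
    (h : ∀ X : P.FullSubcategory, P' X.obj → Q' (e.functor.obj X).obj)
    (h' : ∀ Y : Q.FullSubcategory, Q' Y.obj → P' (e.inverse.obj Y).obj) :
    TriangulatedEquivalent P' Q' := by
  let K : P'.FullSubcategory ⥤ P.FullSubcategory := P.lift P'.ι fun X ↦ hP _ X.2
  let i : K ⋙ P.ι ≅ P'.ι := P.liftCompιIso _ _
  let L : P'.FullSubcategory ⥤ D := K ⋙ e.functor ⋙ Q.ι
  let F : P'.FullSubcategory ⥤ Q'.FullSubcategory := Q'.lift L fun X ↦ h (K.obj X) X.2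
  let j : F ⋙ Q'.ι ≅ L := Q'.liftCompιIso _ _
  have : K.Full := Functor.Full.of_comp_faithful_iso i
  have : K.Faithful := Functor.Faithful.of_comp_iso i
  have : L.Full := inferInstance
  have : L.Faithful := inferInstance
  have : F.Full := Functor.Full.of_comp_faithful_iso j
  have : F.Faithful := Functor.Faithful.of_comp_iso j
  have : F.EssSurj := ⟨fun Y ↦ ⟨⟨(e.inverse.obj ⟨Y.obj, hQ _ Y.2⟩).obj, h' _ Y.2⟩,
    ⟨Q'.isoMk (Q.ι.mapIso (e.counitIso.app ⟨Y.obj, hQ _ Y.2⟩))⟩⟩⟩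
  have : F.IsEquivalence := { }
  refine ⟨F.asEquivalence, (inferInstance : F.CommShift ℤ), fun T hT ↦ ?_⟩
  have hK : P.ι.mapTriangle.obj (K.mapTriangle.obj T) ∈ distTriang C :=
    isomorphic_distinguished _ hT _
      ((Functor.mapTriangleCompIso K P.ι).symm.app T ≪≫ (Functor.mapTriangleIso i).app T)
  refine isomorphic_distinguished _ (he _ hK) _ ?_
  exact (Functor.mapTriangleCompIso F Q'.ι).symm.app T ≪≫ (Functor.mapTriangleIso j).app T ≪≫
    (Functor.mapTriangleCompIso K (e.functor ⋙ Q.ι)).app T ≪≫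
    (Functor.mapTriangleCompIso e.functor Q.ι).app (K.mapTriangle.obj T)

end Restriction

/-! ### Equivalences preserve perfect objects. -/

section Rickard

open DerivedCategory

variable {R S : Type u} [Ring R] [Ring S] [HasDerivedCategory.{w} (ModuleCat.{u} R)]
  [HasDerivedCategory.{w} (ModuleCat.{u} S)]

lemma ge_of_hom_ringObj_eq_zero {X : DerivedCategory (ModuleCat.{u} R)} {k : ℤ}
    (h : ∀ i : ℤ, i < k → ∀ f : (ringObj R)⟦-i⟧ ⟶ X, f = 0) : TStructure.t.ge k X := by
  have : X.IsGE k := by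
    rw [isGE_iff]
    intro i hi
    refine IsZero.of_iso ?_ (homologyShiftIso X i 0 i (by simp)).symm
    rw [ModuleCat.isZero_iff_subsingleton]
    refine subsingleton_of_forall_eq 0 fun x ↦ ?_
    obtain ⟨f, z, rfl⟩ := exists_ringObj_hom x
    have hf : f = 0 := by
      let e := (shiftFunctorCompIsoId (DerivedCategory (ModuleCat.{u} R)) i (-i) (by simp)).app X
      apply (shiftFunctor _ (-i)).map_injective
      rw [← cancel_mono e.hom, Functor.map_zero, zero_comp]
      exact h i hi _
    rw [hf, Functor.map_zero]
    rfl
  exact this.ge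

/-- If `W` corresponds to the ring `S` and lies in degrees `≤ b`, then maps from `S⟦-i⟧` to the
image of `V` are maps from `W⟦-i⟧` to `V`. These vanish for `i < k` when `V` lies in degrees `≥ k +
b`. -/
lemma exists_ge_of_equivalence (hS : IsLeftCoherent S)
    (e : (derivedBoundedMod R).FullSubcategory ≌ (derivedBoundedMod S).FullSubcategory)
    [e.functor.CommShift ℤ] :
    ∃ b : ℤ, ∀ (k : ℤ) (V : (derivedBoundedMod R).FullSubcategory),
      TStructure.t.ge (k + b) V.obj → TStructure.t.ge k (e.functor.obj V).obj := by
  let s : (derivedBoundedMod S).FullSubcategory :=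
    ⟨ringObj S, derivedBoundedMod_of_compact hS (compact_ringObj S)⟩
  let W := e.inverse.obj s
  obtain ⟨b, hb⟩ := W.2.1.2
  refine ⟨b, fun k V hV ↦ ge_of_hom_ringObj_eq_zero fun i hi f ↦ ?_⟩
  let φ : e.functor.obj (W⟦-i⟧) ≅ s⟦-i⟧ :=
    (e.functor.commShiftIso (-i)).app W ≪≫ (shiftFunctor _ (-i)).mapIso (e.counitIso.app s)
  obtain ⟨g, hg⟩ := (derivedBoundedMod S).ι.map_surjective
    (((derivedBoundedMod S).ι.commShiftIso (-i)).hom.app s ≫ f)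
  obtain ⟨l, hl⟩ := e.functor.map_surjective (φ.hom ≫ g)
  have hl0 : l = 0 := by
    apply (derivedBoundedMod R).ι.map_injective
    rw [← cancel_epi (((derivedBoundedMod R).ι.commShiftIso (-i)).inv.app W), Functor.map_zero,
      comp_zero]
    exact zero_of_le_of_ge TStructure.t (m := b + i) (n := k + b) (by lia)
      (TStructure.t.le_shift b (-i) _ (by ring) _ hb.le) hV _
  have hg0 : g = 0 := by
    rw [← cancel_epi φ.hom, ← hl, hl0, Functor.map_zero, comp_zero]
  rw [← cancel_epi (((derivedBoundedMod S).ι.commShiftIso (-i)).hom.app s), ← hg, hg0,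
    Functor.map_zero, comp_zero]

/-- An equivalence between bounded derived categories of finitely presented modules preserves
perfect objects. -/
lemma derivedBoundedProj_of_equivalence (hR : IsLeftCoherent R) (hS : IsLeftCoherent S)
    (e : (derivedBoundedMod R).FullSubcategory ≌ (derivedBoundedMod S).FullSubcategory)
    [e.functor.CommShift ℤ] (X : (derivedBoundedMod R).FullSubcategory)
    (hX : derivedBoundedProj R X.obj) : derivedBoundedProj S (e.functor.obj X).obj := by
  obtain ⟨b, hb⟩ := exists_ge_of_equivalence hS e
  obtain ⟨n, hn⟩ := exists_hom_eq_zero_of_derivedBoundedProj hX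
  refine derivedBoundedProj_of_hom_eq_zero hS (e.functor.obj X).2 (n := n - b) fun Y hY hY' f ↦ ?_
  let Y₁ : (derivedBoundedMod S).FullSubcategory := ⟨Y, hY⟩
  -- Truncate the preimage of `Y` at `n`. Once `p` is zero, every map from `X` to this preimage
  -- factors through `A`, hence vanishes by the choice of `n`.
  obtain ⟨A, Z, hA, hZ, i, p, δ, hT⟩ :=
    TStructure.t.exists_triangle (e.inverse.obj Y₁).obj n (n + 1) rfl
  have hfp := fpCohomology_truncation hR hT (by simpa using hA) hZ (e.inverse.obj Y₁).2.2
  have hZ' : derivedBoundedMod R Z :=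
    ⟨⟨⟨_, ⟨hZ⟩⟩, ObjectProperty.ext_of_isTriangulatedClosed₃ TStructure.t.minus _ hT ⟨n, ⟨hA⟩⟩
      (e.inverse.obj Y₁).2.1.2⟩, hfp.2⟩
  obtain ⟨q, hq⟩ := (derivedBoundedMod R).ι.map_surjective
    (X := e.inverse.obj Y₁) (Y := ⟨Z, hZ'⟩) p
  -- The equivalence turns `q` into a map from `Y`, in degrees `≤ n - b`, to an object in degrees `≥
  -- n + 1 - b`.
  have hq0 : q = 0 := by
    apply e.functor.map_injective
    rw [← cancel_epi (e.counitIso.inv.app Y₁), Functor.map_zero, comp_zero]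
    apply (derivedBoundedMod S).ι.map_injective
    rw [Functor.map_zero]
    exact zero_of_le_of_ge TStructure.t (m := n - b) (n := n + 1 - b) (by lia) hY'
      (hb _ _ (by simpa using hZ)) _
  have hp : p = 0 := by rw [← hq, hq0, Functor.map_zero]
  obtain ⟨g, hg⟩ := (derivedBoundedMod S).ι.map_surjective (X := e.functor.obj X) (Y := Y₁) f
  obtain ⟨l, hl⟩ := e.functor.map_surjective (g ≫ e.counitIso.inv.app Y₁)
  have hl0 : l = 0 := by
    apply (derivedBoundedMod R).ι.map_injective
    obtain ⟨m, hm⟩ := lift_of_distTriang₂ hT ((derivedBoundedMod R).ι.map l)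
      (by rw [hp]; exact comp_zero)
    rw [hm, hn A hA m, zero_comp, Functor.map_zero]
  have hg0 : g = 0 := by
    rw [← cancel_mono (e.counitIso.inv.app Y₁), ← hl, hl0, Functor.map_zero, zero_comp]
  rw [← hg, hg0, Functor.map_zero]

/-- Rickard's implication. -/
theorem triangulatedEquivalent_derivedBoundedProj (hR : IsLeftCoherent R) (hS : IsLeftCoherent S)
    (h : TriangulatedEquivalent (derivedBoundedMod R) (derivedBoundedMod S)) :
    TriangulatedEquivalent (derivedBoundedProj R) (derivedBoundedProj S) := by
  obtain ⟨e, hc, he⟩ := h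
  -- Preservation of perfect objects uses only compatibility with shifts, so nothing about triangles
  -- is needed for the inverse.
  let : e.symm.functor.CommShift ℤ := e.commShiftInverse ℤ
  have : (derivedBoundedProj S).IsClosedUnderIsomorphisms := ⟨derivedBoundedProj_of_iso⟩
  exact triangulatedEquivalent_of_le (derivedBoundedProj_le_derivedBoundedMod hR)
    (derivedBoundedProj_le_derivedBoundedMod hS) e he
    (derivedBoundedProj_of_equivalence hR hS e) (derivedBoundedProj_of_equivalence hS hR e.symm)

end Rickard

end WeakApprox

theorem mainTheorem11 :
    -- weakly approximable and coherent with `T^c ⊆ T^b_c` implies `^⊥(T^b_c) ∩ T^-_c = 0`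
    (∀ (T : Type u) [Category.{v} T] [Preadditive T] [HasZeroObject T] [HasShift T ℤ]
        [∀ n : ℤ, (shiftFunctor T n).Additive] [Pretriangulated T] [IsTriangulated T],
      WeakApprox.IsWeaklyApproximable.{w} T → WeakApprox.IsCoherent.{w} T →
      WeakApprox.compactObjects.{w} T ≤ WeakApprox.boundedPseudoCompactObjects.{w} T →
      ∀ X : T, ((WeakApprox.boundedPseudoCompactObjects.{w} T).leftOrthogonal X ∧
        WeakApprox.pseudoCompactObjects.{w} T X) ↔ IsZero X) ∧
    -- this applies to `D(Mod R)` for a left coherent ring `R`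
    (∀ (R : Type u) [Ring R] [HasDerivedCategory.{v} (ModuleCat.{u} R)],
      WeakApprox.IsLeftCoherent R →
      WeakApprox.IsWeaklyApproximable.{u} (DerivedCategory (ModuleCat.{u} R)) ∧
      WeakApprox.IsCoherent.{u} (DerivedCategory (ModuleCat.{u} R)) ∧
      WeakApprox.compactObjects.{u} (DerivedCategory (ModuleCat.{u} R)) ≤
        WeakApprox.boundedPseudoCompactObjects.{u} (DerivedCategory (ModuleCat.{u} R)) ∧
      ∀ X : DerivedCategory (ModuleCat.{u} R),
        ((WeakApprox.boundedPseudoCompactObjects.{u}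
            (DerivedCategory (ModuleCat.{u} R))).leftOrthogonal X ∧
          WeakApprox.pseudoCompactObjects.{u} (DerivedCategory (ModuleCat.{u} R)) X) ↔
        IsZero X) ∧
    -- Rickard's implication from `D^b(mod R) ≅ D^b(mod S)` to `D^b(proj R) ≅ D^b(proj S)`
    (∀ (R S : Type u) [Ring R] [Ring S] [HasDerivedCategory.{v} (ModuleCat.{u} R)]
        [HasDerivedCategory.{v} (ModuleCat.{u} S)],
      WeakApprox.IsLeftCoherent R → WeakApprox.IsLeftCoherent S →
      WeakApprox.TriangulatedEquivalent (WeakApprox.derivedBoundedMod R)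
        (WeakApprox.derivedBoundedMod S) →
      WeakApprox.TriangulatedEquivalent (WeakApprox.derivedBoundedProj R)
        (WeakApprox.derivedBoundedProj S)) :=
  ⟨fun _ _ _ _ _ _ _ _ hC hcoh hc X ↦ WeakApprox.leftOrthogonal_inf_pseudoCompact_iff hC hcoh hc X,
    fun R _ _ hR ↦ ⟨WeakApprox.isWeaklyApproximable_derivedCategory R,
      WeakApprox.isCoherent_derivedCategory hR, WeakApprox.compact_le_boundedPseudoCompact hR,
      WeakApprox.leftOrthogonal_inf_pseudoCompact_iff
        (WeakApprox.isWeaklyApproximable_derivedCategory R)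
        (WeakApprox.isCoherent_derivedCategory hR)
        (WeakApprox.compact_le_boundedPseudoCompact hR)⟩,
    fun _ _ _ _ _ _ hR hS h ↦ WeakApprox.triangulatedEquivalent_derivedBoundedProj hR hS h⟩
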